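/- Let $k\ge 2$ and let $F_k$ be a free group of rank $k$. Graphs are in the sense of Serre (loops and multiple edges are allowed). A marked metric graph structure on $F_k$ is a triple $(\Gamma,\alpha,\mathcal L)$, where $\Gamma$ is a finite connected graph without vertices of degree one, $\alpha:F_k\to\pi_1(\Gamma,p)$ is an isomorphism for some vertex $p$, and $\mathcal L$ assigns a positive length to every non-oriented edge of $\Gamma$. It is minimal if $\Gamma$ has no vertices of degree one or two, and has volume one if the edge-lengths sum to $1$. Two structures $(\Gamma_i,\alpha_i,\mathcal L_i)$ are equivalent if there are a length-preserving graph isomorphism $\iota:\Gamma_1\to\Gamma_2$ and a path $v$ in $\Gamma_2$ from $\iota(p_1)$ to $p_2$ with $\iota_\#(\alpha_1(f))=v\,\alpha_2(f)\,v^{-1}$ for all $f\in F_k$. The outer space $CV(F_k)$ is the set of equivalence classes of minimal volume-one structures; $\mathrm{Out}(F_k)$ acts on it by changing the marking ($\phi\cdot(\Gamma,\alpha,\mathcal L)=(\Gamma,\alpha\circ\phi^{-1},\mathcal L)$), and $\mathcal M_k=CV(F_k)/\mathrm{Out}(F_k)$. For a point of $\mathcal M_k$ represented by $(\Gamma,\alpha,\mathcal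 L)$, let $X=\widetilde\Gamma$ be the universal cover with the path metric $d$ lifted from $\mathcal L$ and with the action of $F_k$ given by $\alpha$; its volume entropy is $$\overline h(\Gamma,\mathcal L)=\lim_{R\to\infty}\frac1R\log\#\{f\in F_k : d(x,fx)\le R\}.$$ This limit exists and is the same for every vertex $x$ of $X$, and it depends only on the point of $\mathcal M_k$. Theorem. For the function $\overline h:\mathcal M_k\to\mathbb R$ we have $$\min_{\mathcal M_k}\overline h=(3k-3)\log 2 .$$ Moreover, every finite connected graph $\Gamma$ with all vertices of degree three and $\pi_1(\Gamma)\cong F_k$ has exactly $3k-3$ non-oriented edges, and giving each edge of $\Gamma$ length $1/(3k-3)$ defines a point of $\mathcal M_k$ at which $\overline h$ attains this minimum. -/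

import Mathlib

open Filter Topology

noncomputable section

namespace OuterSpace

/-! ## Graphs, edge-paths, homotopy classes of edge-paths -/

/-- A graph in the sense of Serre: vertices, oriented edges, the origin of an oriented edge and the
fixed-point-free involution `e ↦ e⁻¹`. Loops and multiple edges are allowed; a non-oriented edge is
a pair `{e, e⁻¹}`. -/
structure SerreGraph where
  V : Type
  E : Type
  o : E → V
  inv : E → E
  inv_inv : ∀ e, inv (inv e) = e
  inv_ne : ∀ e, inv e ≠ e

namespace SerreGraph

/-- The terminus of an oriented edge. -/
def t (Γ : SerreGraph) (e : Γ.E) : Γ.V := Γ.o (Γ.inv e)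

/-- The degree of a vertex: the number of oriented edges starting there (a loop counts twice). -/
def degree (Γ : SerreGraph) (v : Γ.V) : ℕ := Nat.card {e : Γ.E // Γ.o e = v}

/-- The list of oriented edges `l` is an edge-path from `u` to `v`. -/
def IsWalk (Γ : SerreGraph) : Γ.V → List Γ.E → Γ.V → Prop
  | u, [], v => u = v
  | u, e :: l, v => Γ.o e = u ∧ Γ.IsWalk (Γ.t e) l v

/-- Edge-paths from `u` to `v`. -/
def Walk (Γ : SerreGraph) (u v : Γ.V) : Type := {l : List Γ.E // Γ.IsWalk u l v}

def Connected (Γ : SerreGraph) : Prop := ∀ u v : Γ.V, Nonempty (Γ.Walk u v)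

theorem isWalk_append {Γ : SerreGraph} {l l' : List Γ.E} {u v w : Γ.V}
    (h : Γ.IsWalk u l v) (h' : Γ.IsWalk v l' w) : Γ.IsWalk u (l ++ l') w := by
  induction l generalizing u with
  | nil => cases h; exact h'
  | cons e l ih => exact ⟨h.1, ih h.2⟩

theorem isWalk_reverse {Γ : SerreGraph} {l : List Γ.E} {u v : Γ.V}
    (h : Γ.IsWalk u l v) : Γ.IsWalk v (l.map Γ.inv).reverse u := by
  induction l generalizing u with
  | nil => exact Eq.symm h
  | cons e l ih =>
    rw [List.map_cons, List.reverse_cons]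
    refine isWalk_append (ih h.2) ⟨rfl, ?_⟩
    show Γ.o (Γ.inv (Γ.inv e)) = u
    rw [Γ.inv_inv]; exact h.1

namespace Walk

variable {Γ : SerreGraph}

/-- The constant path. -/
def nil (u : Γ.V) : Γ.Walk u u := ⟨[], rfl⟩

/-- The path consisting of one edge. -/
def single (e : Γ.E) : Γ.Walk (Γ.o e) (Γ.t e) := ⟨[e], rfl, rfl⟩

/-- Concatenation of paths. -/
def append {u v w : Γ.V} (p : Γ.Walk u v) (q : Γ.Walk v w) : Γ.Walk u w :=
  ⟨p.1 ++ q.1, isWalk_append p.2 q.2⟩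

/-- The inverse path. -/
def reverse {u v : Γ.V} (p : Γ.Walk u v) : Γ.Walk v u :=
  ⟨(p.1.map Γ.inv).reverse, isWalk_reverse p.2⟩

/-- The length of a path with respect to an assignment of lengths to oriented edges. -/
def length (L : Γ.E → ℝ) {u v : Γ.V} (p : Γ.Walk u v) : ℝ := (p.1.map L).sum

/-- Elementary homotopy: removal of a back-tracking `e e⁻¹`. -/
def Step {u v : Γ.V} (p q : Γ.Walk u v) : Prop :=
  ∃ (l₁ l₂ : List Γ.E) (e : Γ.E), p.1 = l₁ ++ e :: Γ.inv e :: l₂ ∧ q.1 = l₁ ++ l₂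

end Walk

/-- Homotopy classes (relative to the endpoints) of edge-paths from `u` to `v`: the quotient by the
equivalence relation generated by removal of back-trackings. -/
def HC (Γ : SerreGraph) (u v : Γ.V) : Type := Quot (Walk.Step (Γ := Γ) (u := u) (v := v))

namespace HC

variable {Γ : SerreGraph}

def mk {u v : Γ.V} (p : Γ.Walk u v) : Γ.HC u v := Quot.mk _ p

def one (u : Γ.V) : Γ.HC u u := mk (Walk.nil u)

/-- Concatenation of homotopy classes. -/
def comp {u v w : Γ.V} (a : Γ.HC u v) (b : Γ.HC v w) : Γ.HC u w :=
  Quot.map₂ Walk.append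
    (by
      rintro p q q' ⟨l₁, l₂, e, h, h'⟩
      exact ⟨p.1 ++ l₁, l₂, e, by simp [Walk.append, h], by simp [Walk.append, h']⟩)
    (by
      rintro p p' q ⟨l₁, l₂, e, h, h'⟩
      exact ⟨l₁, l₂ ++ q.1, e, by simp [Walk.append, h], by simp [Walk.append, h']⟩) a b

/-- The class of the inverse path. -/
def symm {u v : Γ.V} (a : Γ.HC u v) : Γ.HC v u :=
  Quot.map Walk.reverse
    (by
      rintro p q ⟨l₁, l₂, e, h, h'⟩
      refine ⟨(l₂.map Γ.inv).reverse, (l₁.map Γ.inv).reverse, e, ?_, ?_⟩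
      · simp [Walk.reverse, h, Γ.inv_inv]
      · simp [Walk.reverse, h']) a

theorem comp_assoc {u v w x : Γ.V} (a : Γ.HC u v) (b : Γ.HC v w) (c : Γ.HC w x) :
    (a.comp b).comp c = a.comp (b.comp c) := by
  induction a using Quot.ind with | _ a => ?_
  induction b using Quot.ind with | _ b => ?_
  induction c using Quot.ind with | _ c => ?_
  exact congrArg (Quot.mk _) (Subtype.ext (List.append_assoc _ _ _))

@[simp] theorem one_comp {u v : Γ.V} (a : Γ.HC u v) : (one u).comp a = a := by
  induction a using Quot.ind with | _ a => ?_
  rfl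

@[simp] theorem comp_one {u v : Γ.V} (a : Γ.HC u v) : a.comp (one v) = a := by
  induction a using Quot.ind with | _ a => ?_
  exact congrArg (Quot.mk _) (Subtype.ext (List.append_nil _))

theorem symm_comp_aux : ∀ (l : List Γ.E) (u v : Γ.V) (h : Γ.IsWalk u l v),
    (mk ⟨l, h⟩).symm.comp (mk ⟨l, h⟩) = one v := by
  intro l
  induction l with
  | nil =>
    intro u v h
    cases h
    rfl
  | cons e l ih =>
    intro u v h
    rw [← ih _ _ h.2]
    refine Quot.sound ⟨(l.map Γ.inv).reverse, l, Γ.inv e, ?_, ?_⟩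
    · simp [Walk.append, Walk.reverse, Γ.inv_inv]
    · simp [Walk.append, Walk.reverse]

@[simp] theorem symm_comp {u v : Γ.V} (a : Γ.HC u v) : a.symm.comp a = one v := by
  induction a using Quot.ind with | _ a => ?_
  exact symm_comp_aux a.1 u v a.2

theorem symm_symm {u v : Γ.V} (a : Γ.HC u v) : a.symm.symm = a := by
  induction a using Quot.ind with | _ a => ?_
  refine congrArg (Quot.mk _) (Subtype.ext ?_)
  simp [Walk.reverse, Function.comp_def, Γ.inv_inv]

@[simp] theorem comp_symm {u v : Γ.V} (a : Γ.HC u v) : a.comp a.symm = one u := by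
  have := symm_comp a.symm
  rwa [symm_symm] at this

@[simp] theorem symm_comp_cancel {u v w : Γ.V} (a : Γ.HC u v) (b : Γ.HC v w) :
    a.symm.comp (a.comp b) = b := by rw [← comp_assoc]; simp

@[simp] theorem comp_symm_cancel {u v w : Γ.V} (a : Γ.HC v u) (b : Γ.HC v w) :
    a.comp (a.symm.comp b) = b := by rw [← comp_assoc]; simp

theorem eq_conj {u v : Γ.V} {q : Γ.HC u v} {a : Γ.HC u u} {b : Γ.HC v v}
    (h : a = (q.comp b).comp q.symm) : b = (q.symm.comp a).comp q := by
  rw [h]; simp [comp_assoc]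

theorem symm_comp_rev {u v w : Γ.V} (a : Γ.HC u v) (b : Γ.HC v w) :
    (a.comp b).symm = b.symm.comp a.symm := by
  have := symm_comp_cancel (a.comp b) (b.symm.comp a.symm)
  rw [← this]; simp [comp_assoc]

theorem conj_conj {u v w : Γ.V} (a : Γ.HC u v) (b : Γ.HC v w) (c : Γ.HC w w) :
    (a.comp ((b.comp c).comp b.symm)).comp a.symm =
      ((a.comp b).comp c).comp (a.comp b).symm := by
  rw [symm_comp_rev]; simp only [comp_assoc]

end HC

/-- The fundamental group: homotopy classes of closed edge-paths at `p`, under concatenation. -/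
abbrev Pi1 (Γ : SerreGraph) (p : Γ.V) : Type := Γ.HC p p

instance (Γ : SerreGraph) (p : Γ.V) : Group (Γ.HC p p) where
  mul a b := HC.comp a b
  one := HC.one p
  inv a := HC.symm a
  mul_assoc a b c := HC.comp_assoc a b c
  one_mul a := HC.one_comp a
  mul_one a := HC.comp_one a
  inv_mul_cancel a := HC.symm_comp a

/-! ## The universal cover and its metric -/

theorem cover_inv_aux {Γ : SerreGraph} {p : Γ.V} (e e' : Γ.E) (h : e' = e)
    (c : Γ.HC p (Γ.o e)) (l : List Γ.E) (hl : Γ.IsWalk (Γ.o e) l (Γ.o e'))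
    (hl' : l = [e, Γ.inv e]) :
    (⟨e', c.comp (HC.mk ⟨l, hl⟩)⟩ : Σ e : Γ.E, Γ.HC p (Γ.o e)) = ⟨e, c⟩ := by
  subst h
  congr 1
  conv_rhs => rw [← HC.comp_one c]
  congr 1
  exact Quot.sound ⟨[], [], e', by simp [hl'], rfl⟩

/-- The universal cover `X` of `(Γ, p)`. Its vertices are the homotopy classes of edge-paths
starting at `p`. An oriented edge `⟨e, c⟩` of `X` is an edge `e` of `Γ` together with a class `c` of
paths from `p` to the origin of `e`; it joins `c` to `c·e`. -/
abbrev cover (Γ : SerreGraph) (p : Γ.V) : SerreGraph where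
  V := Σ v : Γ.V, Γ.HC p v
  E := Σ e : Γ.E, Γ.HC p (Γ.o e)
  o x := ⟨Γ.o x.1, x.2⟩
  inv x := ⟨Γ.inv x.1, x.2.comp (HC.mk (Walk.single x.1))⟩
  inv_inv := by
    rintro ⟨e, c⟩
    simp only [HC.comp_assoc]
    exact cover_inv_aux e _ (Γ.inv_inv e) c _ _ rfl
  inv_ne := by
    rintro ⟨e, c⟩ h
    exact Γ.inv_ne e (congrArg Sigma.fst h)

/-- The lift of the base vertex to the universal cover. -/
def coverBase (Γ : SerreGraph) (p : Γ.V) : (Γ.cover p).V := ⟨p, HC.one p⟩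

/-- Edge-lengths lifted to the universal cover. -/
def liftLength {Γ : SerreGraph} (p : Γ.V) (L : Γ.E → ℝ) : (Γ.cover p).E → ℝ := fun x => L x.1

/-- The path metric on the vertices of a graph with edge-lengths `L`. -/
def dist (Γ : SerreGraph) (L : Γ.E → ℝ) (u v : Γ.V) : ℝ := ⨅ w : Γ.Walk u v, w.length L

/-- The action of the fundamental group on (the vertices of) the universal cover. -/
instance (Γ : SerreGraph) (p : Γ.V) : MulAction (Γ.HC p p) (Γ.cover p).V where
  smul g x := ⟨x.1, HC.comp g x.2⟩
  one_smul x := congrArg (Sigma.mk x.1) (HC.one_comp x.2)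
  mul_smul g h x := congrArg (Sigma.mk x.1) (HC.comp_assoc g h x.2)

/-! ## Isomorphisms of graphs -/

structure Iso (Γ₁ Γ₂ : SerreGraph) where
  onV : Γ₁.V ≃ Γ₂.V
  onE : Γ₁.E ≃ Γ₂.E
  map_o : ∀ e, Γ₂.o (onE e) = onV (Γ₁.o e)
  map_inv : ∀ e, Γ₂.inv (onE e) = onE (Γ₁.inv e)

namespace Iso

variable {Γ₁ Γ₂ Γ₃ : SerreGraph}

abbrev refl (Γ : SerreGraph) : Iso Γ Γ := ⟨Equiv.refl _, Equiv.refl _, fun _ => rfl, fun _ => rfl⟩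

abbrev symm (ι : Iso Γ₁ Γ₂) : Iso Γ₂ Γ₁ where
  onV := ι.onV.symm
  onE := ι.onE.symm
  map_o e := by
    rw [Equiv.eq_symm_apply, ← ι.map_o, Equiv.apply_symm_apply]
  map_inv e := by
    rw [Equiv.eq_symm_apply, ← ι.map_inv, Equiv.apply_symm_apply]

abbrev trans (ι : Iso Γ₁ Γ₂) (κ : Iso Γ₂ Γ₃) : Iso Γ₁ Γ₃ where
  onV := ι.onV.trans κ.onV
  onE := ι.onE.trans κ.onE
  map_o e := by simp [κ.map_o, ι.map_o]
  map_inv e := by simp [κ.map_inv, ι.map_inv]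

theorem isWalk_map (ι : Iso Γ₁ Γ₂) {l : List Γ₁.E} {u v : Γ₁.V} (h : Γ₁.IsWalk u l v) :
    Γ₂.IsWalk (ι.onV u) (l.map ι.onE) (ι.onV v) := by
  induction l generalizing u with
  | nil => exact congrArg ι.onV h
  | cons e l ih =>
    refine ⟨by rw [ι.map_o, h.1], ?_⟩
    have : Γ₂.t (ι.onE e) = ι.onV (Γ₁.t e) := by simp only [t, ι.map_inv, ι.map_o]
    rw [this]
    exact ih h.2

def mapWalk (ι : Iso Γ₁ Γ₂) {u v : Γ₁.V} (w : Γ₁.Walk u v) : Γ₂.Walk (ι.onV u) (ι.onV v) :=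
  ⟨w.1.map ι.onE, ι.isWalk_map w.2⟩

/-- The map `ι_#` induced on homotopy classes of paths. -/
def map (ι : Iso Γ₁ Γ₂) {u v : Γ₁.V} (a : Γ₁.HC u v) : Γ₂.HC (ι.onV u) (ι.onV v) :=
  Quot.map ι.mapWalk
    (by
      rintro p q ⟨l₁, l₂, e, h, h'⟩
      exact ⟨l₁.map ι.onE, l₂.map ι.onE, ι.onE e, by simp [mapWalk, h, ι.map_inv],
        by simp [mapWalk, h']⟩) a

theorem map_comp (ι : Iso Γ₁ Γ₂) {u v w : Γ₁.V} (a : Γ₁.HC u v) (b : Γ₁.HC v w) :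
    ι.map (a.comp b) = (ι.map a).comp (ι.map b) := by
  induction a using Quot.ind with | _ a => ?_
  induction b using Quot.ind with | _ b => ?_
  exact congrArg (Quot.mk _) (Subtype.ext List.map_append)

theorem map_symm (ι : Iso Γ₁ Γ₂) {u v : Γ₁.V} (a : Γ₁.HC u v) :
    ι.map a.symm = (ι.map a).symm := by
  induction a using Quot.ind with | _ a => ?_
  refine congrArg (Quot.mk _) (Subtype.ext ?_)
  simp [mapWalk, Walk.reverse, Function.comp_def, ι.map_inv]

theorem map_refl {Γ : SerreGraph} {u v : Γ.V} (a : Γ.HC u v) : (refl Γ).map a = a := by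
  induction a using Quot.ind with | _ a => ?_
  exact congrArg (Quot.mk _) (Subtype.ext (List.map_id _))

theorem map_trans (ι : Iso Γ₁ Γ₂) (κ : Iso Γ₂ Γ₃) {u v : Γ₁.V} (a : Γ₁.HC u v) :
    (ι.trans κ).map a = κ.map (ι.map a) := by
  induction a using Quot.ind with | _ a => ?_
  refine congrArg (Quot.mk _) (Subtype.ext ?_)
  simp [mapWalk, trans]

end Iso

/-- Transport of a homotopy class along equalities of its endpoints. -/
def HC.cast {Γ : SerreGraph} {u u' v v' : Γ.V} (hu : u = u') (hv : v = v') (a : Γ.HC u v) :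
    Γ.HC u' v' := hu ▸ hv ▸ a

theorem HC.cast_comp {Γ : SerreGraph} {u u' v v' w w' : Γ.V} (hu : u = u') (hv : v = v')
    (hw : w = w') (a : Γ.HC u v) (b : Γ.HC v w) :
    HC.cast hu hw (a.comp b) = (HC.cast hu hv a).comp (HC.cast hv hw b) := by
  subst hu hv hw; rfl

theorem HC.cast_symm {Γ : SerreGraph} {u u' v v' : Γ.V} (hu : u = u') (hv : v = v')
    (a : Γ.HC u v) : HC.cast hv hu a.symm = (HC.cast hu hv a).symm := by
  subst hu hv; rfl

theorem HC.cast_mk {Γ : SerreGraph} {u u' v v' : Γ.V} (hu : u = u') (hv : v = v')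
    (l : List Γ.E) (h : Γ.IsWalk u l v) (h' : Γ.IsWalk u' l v') :
    HC.cast hu hv (HC.mk ⟨l, h⟩) = HC.mk ⟨l, h'⟩ := by
  subst hu hv; rfl

theorem Iso.symm_map_map {Γ₁ Γ₂ : SerreGraph} (ι : Iso Γ₁ Γ₂) {u v : Γ₁.V} (a : Γ₁.HC u v) :
    HC.cast (ι.onV.symm_apply_apply u) (ι.onV.symm_apply_apply v) (ι.symm.map (ι.map a)) = a := by
  induction a using Quot.ind with | _ a => ?_
  refine (HC.cast_mk (u := ι.symm.onV (ι.onV u)) (v := ι.symm.onV (ι.onV v))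
    _ _ ((a.1.map ι.onE).map ι.symm.onE) _ (by simpa [Iso.symm] using a.2)).trans ?_
  refine congrArg (Quot.mk _) (Subtype.ext ?_)
  simp

end SerreGraph

open SerreGraph

/-! ## Marked metric graphs, outer space, moduli space -/

variable {F : Type*} [Group F]

/-- A marked metric graph structure on the group `F`: a finite connected graph `Γ` without
degree-one vertices, an isomorphism `α` of `F` with the fundamental group of `Γ`, and an assignment
`L` of positive lengths to the non-oriented edges of `Γ`. -/
structure MarkedMetricGraph (F : Type*) [Group F] where
  Γ : SerreGraph
  finV : Finite Γ.V
  finE : Finite Γ.E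
  connected : Γ.Connected
  degree_ne_one : ∀ v, Γ.degree v ≠ 1
  p : Γ.V
  α : F ≃* Γ.Pi1 p
  L : Γ.E → ℝ
  L_inv : ∀ e, L (Γ.inv e) = L e
  L_pos : ∀ e, 0 < L e

namespace MarkedMetricGraph

/-- The sum of the lengths of the non-oriented edges. -/
def volume (m : MarkedMetricGraph F) : ℝ := (1 / 2) * ∑ᶠ e, m.L e

/-- No vertices of degree one or two. -/
def IsMinimal (m : MarkedMetricGraph F) : Prop := ∀ v, m.Γ.degree v ≠ 1 ∧ m.Γ.degree v ≠ 2

/-- Every vertex has degree three. -/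
def IsTrivalent (m : MarkedMetricGraph F) : Prop := ∀ v, m.Γ.degree v = 3

/-- The universal cover of the underlying graph. -/
abbrev X (m : MarkedMetricGraph F) : SerreGraph := m.Γ.cover m.p

/-- The base vertex of the universal cover. -/
def x₀ (m : MarkedMetricGraph F) : m.X.V := m.Γ.coverBase m.p

/-- The metric on the universal cover. -/
def d (m : MarkedMetricGraph F) (x y : m.X.V) : ℝ := m.X.dist (liftLength m.p m.L) x y

/-- The number of `f ∈ F` with `d (x, f x) ≤ R`. -/
def orbitCount (m : MarkedMetricGraph F) (x : m.X.V) (R : ℝ) : ℕ :=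
  Nat.card {f : F // m.d x (m.α f • x) ≤ R}

/-- The volume entropy `lim_{R → ∞} (1/R) log #{f ∈ F : d (x₀, f x₀) ≤ R}` of the universal
cover. -/
def entropy (m : MarkedMetricGraph F) : ℝ :=
  limUnder atTop (fun R : ℝ => Real.log (m.orbitCount m.x₀ R) / R)

/-- Equivalence of marked metric graph structures: there are a length-preserving isomorphism `ι` of
the graphs and (the homotopy class of) a path `v` from `ι p₁` to `p₂` such that
`ι_# (α₁ f) = v (α₂ f) v⁻¹` for all `f`. -/
def Equivalent (m₁ m₂ : MarkedMetricGraph F) : Prop :=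
  ∃ ι : Iso m₁.Γ m₂.Γ, (∀ e, m₂.L (ι.onE e) = m₁.L e) ∧
    ∃ v : m₂.Γ.HC (ι.onV m₁.p) m₂.p,
      ∀ f : F, ι.map (m₁.α f) = (v.comp (m₂.α f)).comp v.symm

theorem Equivalent.refl (m : MarkedMetricGraph F) : Equivalent m m := by
  refine ⟨Iso.refl _, fun _ => rfl, HC.one m.p, fun f => ?_⟩
  exact (Iso.map_refl _).trans ((HC.comp_one _).trans (HC.one_comp _)).symm

theorem Equivalent.symm {m₁ m₂ : MarkedMetricGraph F} (h : Equivalent m₁ m₂) :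
    Equivalent m₂ m₁ := by
  obtain ⟨ι, hL, v, hv⟩ := h
  have hp := ι.onV.symm_apply_apply m₁.p
  refine ⟨ι.symm, fun e => ?_, HC.cast rfl hp (ι.symm.map v.symm), fun f => ?_⟩
  · rw [← hL]; exact congrArg m₂.L (ι.onE.apply_symm_apply e)
  · have h1 := ι.symm_map_map (m₁.α f)
    have h2 : m₂.α f = (v.symm.comp (ι.map (m₁.α f))).comp v := by
      rw [hv]; simp [HC.comp_assoc]
    rw [h2, Iso.map_comp, Iso.map_comp]
    conv_rhs => rw [← h1]
    have h3 : HC.cast hp rfl (ι.symm.map v) = (HC.cast rfl hp (ι.symm.map v.symm)).symm := by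
      rw [← HC.cast_symm, ← Iso.map_symm, HC.symm_symm]
    have h4 := HC.cast_comp (rfl : ι.symm.onV m₂.p = _) hp hp (ι.symm.map v.symm)
      (ι.symm.map (ι.map (m₁.α f)))
    have h5 := HC.cast_comp (rfl : ι.symm.onV m₂.p = _) hp rfl
      ((ι.symm.map v.symm).comp (ι.symm.map (ι.map (m₁.α f)))) (ι.symm.map v)
    rw [h3, h4] at h5
    exact h5

theorem Equivalent.trans {m₁ m₂ m₃ : MarkedMetricGraph F} (h : Equivalent m₁ m₂)
    (h' : Equivalent m₂ m₃) : Equivalent m₁ m₃ := by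
  obtain ⟨ι, hL, v, hv⟩ := h
  obtain ⟨κ, hL', v', hv'⟩ := h'
  refine ⟨ι.trans κ, fun e => (hL' _).trans (hL e), (κ.map v).comp v', fun f => ?_⟩
  rw [Iso.map_trans, hv, Iso.map_comp, Iso.map_comp, hv', Iso.map_symm]
  exact HC.conj_conj (κ.map v) v' (m₃.α f)

/-! ### The entropy depends only on the equivalence class -/

theorem exists_lift {Γ : SerreGraph} (p : Γ.V) (L : Γ.E → ℝ) :
    ∀ (l : List Γ.E) (u v : Γ.V) (h : Γ.IsWalk u l v) (c : Γ.HC p u),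
      ∃ w : (Γ.cover p).Walk ⟨u, c⟩ ⟨v, c.comp (HC.mk ⟨l, h⟩)⟩,
        w.length (liftLength p L) = (l.map L).sum := by
  intro l
  induction l with
  | nil =>
    intro u v h c
    cases h
    refine ⟨⟨[], ?_⟩, rfl⟩
    exact congrArg (Sigma.mk u) (HC.comp_one c).symm
  | cons e l ih =>
    intro u v h c
    obtain ⟨rfl, h2⟩ := h
    obtain ⟨w, hw⟩ := ih (Γ.t e) v h2 (c.comp (HC.mk (Walk.single e)))
    refine ⟨⟨⟨e, c⟩ :: w.1, rfl, ?_⟩, ?_⟩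
    · have h3 := w.2
      have key : (c.comp (HC.mk (Walk.single e))).comp (HC.mk ⟨l, h2⟩) =
          c.comp (HC.mk ⟨e :: l, rfl, h2⟩) := HC.comp_assoc _ _ _
      exact key ▸ h3
    · exact congrArg (L e + ·) hw

theorem exists_proj {Γ : SerreGraph} (p : Γ.V) (L : Γ.E → ℝ) :
    ∀ (l : List (Γ.cover p).E) (x y : (Γ.cover p).V) (_ : (Γ.cover p).IsWalk x l y),
      ∃ w : Γ.Walk x.1 y.1, x.2.comp (HC.mk w) = y.2 ∧
        w.length L = (l.map (liftLength p L)).sum := by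
  intro l
  induction l with
  | nil =>
    intro x y h
    cases h
    exact ⟨Walk.nil _, HC.comp_one _, rfl⟩
  | cons e l ih =>
    intro x y h
    obtain ⟨rfl, h2⟩ := h
    obtain ⟨w, hw, hw'⟩ := ih _ y h2
    refine ⟨(Walk.single e.1).append w, ?_, ?_⟩
    · rw [← hw]
      exact (HC.comp_assoc e.2 (HC.mk (Walk.single e.1)) (HC.mk w)).symm
    · exact congrArg (L e.1 + ·) hw'

theorem length_nonneg {Γ : SerreGraph} {L : Γ.E → ℝ} (hL : ∀ e, 0 < L e) {u v : Γ.V}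
    (w : Γ.Walk u v) : 0 ≤ w.length L :=
  List.sum_nonneg (by
    intro x hx
    obtain ⟨e, -, rfl⟩ := List.mem_map.1 hx
    exact (hL e).le)

theorem d_le (m : MarkedMetricGraph F) (g : m.Γ.Pi1 m.p) (w : m.Γ.Walk m.p m.p)
    (h : HC.mk w = g) : m.d m.x₀ (g • m.x₀) ≤ w.length m.L := by
  obtain ⟨w', hw'⟩ := exists_lift m.p m.L w.1 _ _ w.2 (HC.one m.p)
  have key : (⟨m.p, (HC.one m.p).comp (HC.mk ⟨w.1, w.2⟩)⟩ : m.X.V) = g • m.x₀ := by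
    refine congrArg (Sigma.mk m.p) ?_
    rw [HC.one_comp]
    exact h.trans (HC.comp_one g).symm
  rw [← key, Walk.length, ← hw']
  refine ciInf_le ⟨0, ?_⟩ w'
  rintro _ ⟨w, rfl⟩
  exact length_nonneg (L := liftLength m.p m.L) (fun e => m.L_pos (Sigma.fst e)) w

theorem exists_walk (m : MarkedMetricGraph F) (g : m.Γ.Pi1 m.p) (R : ℝ)
    (h : m.d m.x₀ (g • m.x₀) < R) :
    ∃ w : m.Γ.Walk m.p m.p, HC.mk w = g ∧ w.length m.L < R := by
  have hne : Nonempty (m.X.Walk m.x₀ (g • m.x₀)) := by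
    obtain ⟨w, hw⟩ := Quot.exists_rep g
    obtain ⟨w', -⟩ := exists_lift m.p m.L w.1 _ _ w.2 (HC.one m.p)
    have key : (⟨m.p, (HC.one m.p).comp (HC.mk ⟨w.1, w.2⟩)⟩ : m.X.V) = g • m.x₀ := by
      refine congrArg (Sigma.mk m.p) ?_
      rw [HC.one_comp]
      exact Eq.trans hw (HC.comp_one g).symm
    rw [← key]
    exact ⟨w'⟩
  obtain ⟨w, hw⟩ := exists_lt_of_ciInf_lt h
  obtain ⟨w', h1, h2⟩ := exists_proj m.p m.L w.1 _ _ w.2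
  refine ⟨w', ?_, ?_⟩
  · exact (HC.one_comp (HC.mk w')).symm.trans (h1.trans (HC.comp_one g))
  · exact lt_of_eq_of_lt h2 hw

theorem finite_orbit (m : MarkedMetricGraph F) (R : ℝ) :
    Finite {f : F // m.d m.x₀ (m.α f • m.x₀) ≤ R} := by
  classical
  have := m.finE
  obtain ⟨δ, hδ, hδL⟩ : ∃ δ : ℝ, 0 < δ ∧ ∀ e, δ ≤ m.L e := by
    rcases isEmpty_or_nonempty m.Γ.E with hE | hE
    · exact ⟨1, one_pos, fun e => hE.elim e⟩
    · obtain ⟨e, he⟩ := Finite.exists_min m.L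
      exact ⟨m.L e, m.L_pos e, he⟩
  obtain ⟨n, hn⟩ := exists_nat_gt ((R + 1) / δ)
  have hfin := List.finite_length_le m.Γ.E n
  have hlen : ∀ l : List m.Γ.E, l.length * δ ≤ (l.map m.L).sum := by
    intro l
    induction l with
    | nil => simp
    | cons e l ih =>
      simp only [List.length_cons, List.map_cons, List.sum_cons]
      push_cast
      linarith [hδL e]
  let φ : List m.Γ.E → F := fun l =>
    if h : m.Γ.IsWalk m.p l m.p then m.α.symm (HC.mk ⟨l, h⟩) else 1
  refine Set.Finite.to_subtype (s := {f : F | m.d m.x₀ (m.α f • m.x₀) ≤ R})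
    ((hfin.image φ).subset ?_)
  intro f hf
  obtain ⟨w, hw, hw'⟩ := m.exists_walk (m.α f) (R + 1) (lt_of_le_of_lt hf (by linarith))
  refine ⟨w.1, ?_, ?_⟩
  · have h1 := hlen w.1
    have h2 : (w.1.length : ℝ) * δ < R + 1 := lt_of_le_of_lt h1 hw'
    have h3 : (w.1.length : ℝ) < (R + 1) / δ := by rwa [lt_div_iff₀ hδ]
    exact_mod_cast (h3.trans hn).le
  · have : φ w.1 = m.α.symm (HC.mk w) := dif_pos w.2
    rw [this, hw]
    exact m.α.symm_apply_apply f

theorem one_le_orbitCount (m : MarkedMetricGraph F) {R : ℝ} (hR : 0 ≤ R) :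
    1 ≤ m.orbitCount m.x₀ R := by
  have := m.finite_orbit R
  have : Nonempty {f : F // m.d m.x₀ (m.α f • m.x₀) ≤ R} := by
    refine ⟨1, (m.d_le _ (Walk.nil _) ?_).trans ?_⟩
    · rw [map_one]; rfl
    · simpa [Walk.length, Walk.nil] using hR
  exact Nat.card_pos

theorem Equivalent.orbitCount_le {m₁ m₂ : MarkedMetricGraph F} (h : Equivalent m₁ m₂) :
    ∃ C : ℝ, 0 ≤ C ∧ ∀ R, m₁.orbitCount m₁.x₀ R ≤ m₂.orbitCount m₂.x₀ (R + C) := by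
  obtain ⟨ι, hL, v, hv⟩ := h
  obtain ⟨q, rfl⟩ := Quot.exists_rep v
  have hq := length_nonneg m₂.L_pos q
  refine ⟨2 * q.length m₂.L, by linarith, fun R => ?_⟩
  have := m₂.finite_orbit (R + 2 * q.length m₂.L)
  have key : ∀ f : F, m₁.d m₁.x₀ (m₁.α f • m₁.x₀) ≤ R →
      m₂.d m₂.x₀ (m₂.α f • m₂.x₀) ≤ R + 2 * q.length m₂.L := by
    intro f hf
    refine le_of_forall_pos_lt_add fun ε hε => ?_
    obtain ⟨w, hw, hw'⟩ := m₁.exists_walk (m₁.α f) (R + ε) (lt_of_le_of_lt hf (by linarith))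
    refine lt_of_le_of_lt
      (m₂.d_le (m₂.α f) ((q.reverse.append (ι.mapWalk w)).append q) ?_) ?_
    · have h1 := hv f
      rw [← hw] at h1
      exact (HC.eq_conj (q := HC.mk q) h1).symm
    · have e1 : (q.reverse).length m₂.L = q.length m₂.L := by
        simp [Walk.length, Walk.reverse, Function.comp_def, m₂.L_inv, List.sum_reverse]
      have e2 : (ι.mapWalk w).length m₂.L = w.length m₁.L := by
        simp [Walk.length, Iso.mapWalk, Function.comp_def, hL]
      have e3 : ((q.reverse.append (ι.mapWalk w)).append q).length m₂.L =
          q.reverse.length m₂.L + (ι.mapWalk w).length m₂.L + q.length m₂.L := by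
        simp [Walk.length, Walk.append, add_assoc]
      rw [e3, e1, e2]
      linarith
  exact Nat.card_le_card_of_injective (fun f => ⟨f.1, key f.1 f.2⟩)
    (fun a b hab => Subtype.ext (congrArg (fun z => z.1) hab))

theorem tendsto_of_le {N₁ N₂ : ℝ → ℕ} {C : ℝ} (hC : 0 ≤ C) (h₁ : ∀ R, 0 ≤ R → 1 ≤ N₁ R)
    (h₂ : ∀ R, 0 ≤ R → 1 ≤ N₂ R)
    (h₁₂ : ∀ R, N₁ R ≤ N₂ (R + C)) (h₂₁ : ∀ R, N₂ R ≤ N₁ (R + C)) {a : ℝ}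
    (h : Tendsto (fun R : ℝ => Real.log (N₁ R) / R) atTop (𝓝 a)) :
    Tendsto (fun R : ℝ => Real.log (N₂ R) / R) atTop (𝓝 a) := by
  have hs : ∀ c : ℝ, Tendsto (fun R : ℝ => Real.log (N₁ (R + c)) / R) atTop (𝓝 a) := by
    intro c
    have t1 := h.comp (tendsto_atTop_add_const_right atTop c tendsto_id)
    have t2 : Tendsto (fun R : ℝ => 1 + c / R) atTop (𝓝 1) := by
      simpa using (tendsto_const_nhds (x := (1 : ℝ))).add
        ((tendsto_const_nhds (x := c)).div_atTop tendsto_id)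
    have t3 := t1.mul t2
    rw [mul_one] at t3
    refine t3.congr' ?_
    filter_upwards [eventually_gt_atTop 0, eventually_gt_atTop (-c)] with R hR hR'
    have : R + c ≠ 0 := by linarith
    simp only [Function.comp, id]
    field_simp
  refine tendsto_of_tendsto_of_tendsto_of_le_of_le' (hs (-C)) (hs C) ?_ ?_
  · filter_upwards [eventually_ge_atTop C] with R hR
    have hR0 : 0 ≤ R := hC.trans hR
    have := h₁₂ (R + -C)
    rw [neg_add_cancel_right] at this
    have h1 := h₁ (R + -C) (by linarith)
    gcongr
  · filter_upwards [eventually_ge_atTop 0] with R hR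
    have h1 := h₂ R hR
    have := h₂₁ R
    gcongr

theorem Equivalent.tendsto {m₁ m₂ : MarkedMetricGraph F} (h : Equivalent m₁ m₂) {a : ℝ}
    (ha : Tendsto (fun R : ℝ => Real.log (m₁.orbitCount m₁.x₀ R) / R) atTop (𝓝 a)) :
    Tendsto (fun R : ℝ => Real.log (m₂.orbitCount m₂.x₀ R) / R) atTop (𝓝 a) := by
  obtain ⟨C, hC, hC'⟩ := h.orbitCount_le
  obtain ⟨D, hD, hD'⟩ := h.symm.orbitCount_le
  have mono : ∀ (m : MarkedMetricGraph F) {R S : ℝ}, R ≤ S →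
      m.orbitCount m.x₀ R ≤ m.orbitCount m.x₀ S := by
    intro m R S hRS
    have := m.finite_orbit S
    exact Nat.card_le_card_of_injective (fun f => ⟨f.1, f.2.trans hRS⟩)
      (fun a b hab => Subtype.ext (congrArg (fun z => z.1) hab))
  exact tendsto_of_le (C := C + D) (by linarith) (fun R hR => m₁.one_le_orbitCount hR)
    (fun R hR => m₂.one_le_orbitCount hR)
    (fun R => (hC' R).trans (mono m₂ (by linarith)))
    (fun R => (hD' R).trans (mono m₁ (by linarith))) ha

theorem Equivalent.entropy_eq {m₁ m₂ : MarkedMetricGraph F} (h : Equivalent m₁ m₂) :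
    m₁.entropy = m₂.entropy := by
  unfold entropy limUnder lim
  congr 1
  funext a
  exact propext ⟨h.tendsto, h.symm.tendsto⟩

/-! ### Change of marking -/

/-- The left action of `φ ∈ Aut F` on markings: precomposition with `φ⁻¹`. -/
def remark (φ : MulAut F) (m : MarkedMetricGraph F) : MarkedMetricGraph F :=
  { m with α := (φ⁻¹ : MulAut F).trans m.α }

theorem Equivalent.remark {m₁ m₂ : MarkedMetricGraph F} (h : Equivalent m₁ m₂) (φ : MulAut F) :
    Equivalent (m₁.remark φ) (m₂.remark φ) := by
  obtain ⟨ι, hL, v, hv⟩ := h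
  exact ⟨ι, hL, v, fun f => hv ((φ⁻¹ : MulAut F) f)⟩

theorem remark_conj (g : F) (m : MarkedMetricGraph F) :
    Equivalent (m.remark (MulAut.conj g)) m := by
  refine ⟨Iso.refl _, fun _ => rfl, m.α g⁻¹, fun f => ?_⟩
  refine (Iso.map_refl (Γ := m.Γ) _).trans ?_
  change m.α ((MulAut.conj g)⁻¹ f) = m.α g⁻¹ * m.α f * (m.α g⁻¹)⁻¹
  rw [← map_inv MulAut.conj, ← map_inv m.α, ← map_mul m.α, ← map_mul m.α]
  exact congrArg m.α (by simp)

theorem entropy_remark (φ : MulAut F) (m : MarkedMetricGraph F) :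
    (m.remark φ).entropy = m.entropy := by
  have : ∀ R, (m.remark φ).orbitCount (m.remark φ).x₀ R = m.orbitCount m.x₀ R := fun R =>
    Nat.card_congr ((φ⁻¹ : MulAut F).toEquiv.subtypeEquiv fun f => Iff.rfl)
  unfold entropy
  simp only [this]

end MarkedMetricGraph

/-- The volume-one minimal marked metric graph structures on `F`. -/
def VolOneMin (F : Type*) [Group F] := {m : MarkedMetricGraph F // m.IsMinimal ∧ m.volume = 1}

instance equivSetoid (F : Type*) [Group F] : Setoid (VolOneMin F) where
  r a b := MarkedMetricGraph.Equivalent a.1 b.1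
  iseqv := ⟨fun a => .refl a.1, fun h => h.symm, fun h h' => h.trans h'⟩

/-- The Culler-Vogtmann outer space of `F`: equivalence classes of volume-one minimal marked metric
graph structures. -/
def CV (F : Type*) [Group F] := Quotient (equivSetoid F)

/-- The point of outer space represented by a marked metric graph structure. -/
def CV.mk (m : VolOneMin F) : CV F := Quotient.mk _ m

instance : MulAction (MulAut F) (CV F) where
  smul φ := Quotient.map (fun m : VolOneMin F => (⟨m.1.remark φ, m.2⟩ : VolOneMin F))
    (fun _ _ h => MarkedMetricGraph.Equivalent.remark h φ)
  one_smul x := by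
    induction x using Quotient.ind
    rfl
  mul_smul φ ψ x := by
    induction x using Quotient.ind
    rfl

instance (F : Type*) [Group F] : (MulAut.conj : F →* MulAut F).range.Normal where
  conj_mem := by
    rintro _ ⟨g, rfl⟩ φ
    refine ⟨φ g, ?_⟩
    ext f
    simp [MulAut.mul_apply]

/-- The outer automorphism group. -/
abbrev Out (F : Type*) [Group F] := MulAut F ⧸ (MulAut.conj : F →* MulAut F).range

/-- The action of `Out F` on outer space as a homomorphism to the permutations; it is induced by
the action of `Aut F`. -/
def outHom (F : Type*) [Group F] : Out F →* Equiv.Perm (CV F) :=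
  QuotientGroup.lift _ (MulAction.toPermHom (MulAut F) (CV F)) (by
    rintro _ ⟨g, rfl⟩
    ext x
    induction x using Quotient.ind with | _ m => ?_
    exact Quotient.sound (MarkedMetricGraph.remark_conj g m.1))

instance : MulAction (Out F) (CV F) := MulAction.compHom (CV F) (outHom F)

/-- The moduli space `CV(F) / Out(F)`. -/
abbrev Moduli (F : Type*) [Group F] := MulAction.orbitRel.Quotient (Out F) (CV F)

/-- The volume entropy as a function on outer space. -/
def CV.entropy : CV F → ℝ :=
  Quotient.lift (fun m : VolOneMin F => m.1.entropy)
    (fun _ _ h => MarkedMetricGraph.Equivalent.entropy_eq h)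

theorem CV.entropy_smul (φ : Out F) (x : CV F) : CV.entropy (φ • x) = CV.entropy x := by
  induction φ using QuotientGroup.induction_on with | H φ => ?_
  induction x using Quotient.ind with | _ m => ?_
  exact MarkedMetricGraph.entropy_remark φ m.1

/-- The point of the moduli space represented by a marked metric graph structure. -/
def Moduli.mk (m : VolOneMin F) : Moduli F := Quotient.mk _ (CV.mk m)

/-- The volume entropy as a function on the moduli space. -/
def Moduli.entropy : Moduli F → ℝ :=
  Quotient.lift CV.entropy (by
    rintro a b ⟨φ, rfl⟩
    exact CV.entropy_smul φ b)

end OuterSpace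

end

/-!
The homotopy class of an edge-path contains exactly one reduced edge-path, and the distance in the
universal cover is the length of the reduced edge-path (`MarkedMetricGraph.d_eq_len`). Hence the
orbit count at a vertex is the number of reduced closed edge-paths of length at most `R`
(`MarkedMetricGraph.orbitCount_eq`). Cutting a reduced edge-path at distance about `R` from its
origin shows that this number is submultiplicative up to a bounded change of the radius, so the
limit that defines the entropy exists by Fekete's lemma, and changing the base vertex changes the
radius by a bounded amount only (`MarkedMetricGraph.tendsto_entropy`).

The relation `|E| = 2 (k + |V| - 1)` between the numbers of oriented edges and of vertices is
obtained by counting `ℤˣ`-valued cochains in two ways (`SerreGraph.card_cochain`,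
`SerreGraph.card_cochain_eq`).

Lower bound: consider the random walk on oriented edges which never back-tracks and chooses the next
edge uniformly. The uniform measure is stationary for it, its entropy per step is the mean of
`log (d - 1)` over the degrees `d` of the termini, and the mean length of an edge is `2 / |E|` for
volume one. By Jensen's inequality, the sum of `exp (-s * length)` over the reduced edge-paths with
`n` edges grows exponentially in `n` if `s` is smaller than the entropy of the walk divided by the
mean length (`SerreGraph.sum_log_pathSum_ge`), whereas it is at most linear in `n` if `s` exceeds the
volume entropy (`SerreGraph.exists_pathSum_le`). So the volume entropy is at least half of the sum
of `d * log (d - 1)` over the vertices. As `d * log (d - 1) ≥ 3 * log 2 * (d - 2)` for `d ≥ 3`, and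
as the sum of `d - 2` is `2 k - 2`, this is at least `(3 k - 3) * log 2`.

Equality: in a trivalent graph there are `2 ^ n` reduced edge-paths with `n + 1` edges and a given
first edge, which gives the upper bound if all edges have the length `1 / (3 k - 3)`. Trivalent
graphs exist for every `k`: `SerreGraph.loopChain` is a path with additional edges, and its
fundamental group is free on the loops through the additional edges (`SerreGraph.pi1Equiv`).
-/

noncomputable section

namespace OuterSpace

/-! ### Reduced edge-paths -/

namespace SerreGraph

variable {Γ : SerreGraph}

/-- An edge-path without back-tracking. -/
def IsReduced (Γ : SerreGraph) : List Γ.E → Prop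
  | [] => True
  | [_] => True
  | e :: f :: l => f ≠ Γ.inv e ∧ IsReduced Γ (f :: l)

theorem IsReduced.tail {e : Γ.E} {l : List Γ.E} (h : Γ.IsReduced (e :: l)) : Γ.IsReduced l := by
  cases l with
  | nil => trivial
  | cons f l => exact h.2

open Classical in
/-- Prepend an edge to a reduced edge-path and cancel the back-tracking that this may create. -/
def reduceCons (e : Γ.E) : List Γ.E → List Γ.E
  | [] => [e]
  | f :: l => if f = Γ.inv e then l else e :: f :: l

open Classical in
theorem reduceCons_cons (e f : Γ.E) (l : List Γ.E) :
    reduceCons e (f :: l) = if f = Γ.inv e then l else e :: f :: l := rfl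

/-- Removal of all back-trackings, from the right to the left. -/
def reduce (l : List Γ.E) : List Γ.E := l.foldr reduceCons []

@[simp] theorem reduce_cons (e : Γ.E) (l : List Γ.E) :
    reduce (e :: l) = reduceCons e (reduce l) := rfl

theorem IsReduced.reduceCons {l : List Γ.E} (h : Γ.IsReduced l) (e : Γ.E) :
    Γ.IsReduced (reduceCons e l) := by
  cases l with
  | nil => trivial
  | cons f l =>
    rw [reduceCons_cons]
    split_ifs with hf
    · exact h.tail
    · exact ⟨hf, h⟩

theorem isReduced_reduce (l : List Γ.E) : Γ.IsReduced (reduce l) := by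
  induction l with
  | nil => trivial
  | cons e l ih => exact ih.reduceCons e

theorem IsReduced.reduceCons_eq {e : Γ.E} {l : List Γ.E} (h : Γ.IsReduced (e :: l)) :
    SerreGraph.reduceCons e l = e :: l := by
  cases l with
  | nil => rfl
  | cons f l => exact if_neg h.1

theorem IsReduced.reduce_eq {l : List Γ.E} (h : Γ.IsReduced l) : reduce l = l := by
  induction l with
  | nil => rfl
  | cons e l ih => rw [reduce_cons, ih h.tail, h.reduceCons_eq]

/-- Cancellation of a back-tracking; this makes `reduce` invariant under homotopy. -/
theorem IsReduced.reduceCons_reduceCons_inv {l : List Γ.E} (h : Γ.IsReduced l) (e : Γ.E) :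
    SerreGraph.reduceCons e (SerreGraph.reduceCons (Γ.inv e) l) = l := by
  cases l with
  | nil => simp [SerreGraph.reduceCons]
  | cons f l =>
    by_cases hf : f = e
    · subst hf
      simp only [SerreGraph.reduceCons, Γ.inv_inv, if_true]
      exact h.reduceCons_eq
    · simp [SerreGraph.reduceCons, Γ.inv_inv, hf]

theorem reduce_append (l l' : List Γ.E) : reduce (l ++ l') = l.foldr reduceCons (reduce l') := by
  simp [reduce]

theorem reduce_backtrack (l₁ l₂ : List Γ.E) (e : Γ.E) :
    reduce (l₁ ++ e :: Γ.inv e :: l₂) = reduce (l₁ ++ l₂) := by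
  rw [reduce_append, reduce_append, reduce_cons, reduce_cons,
    (isReduced_reduce l₂).reduceCons_reduceCons_inv]

theorem isWalk_reduceCons {u v : Γ.V} {e : Γ.E} {l : List Γ.E} (h : Γ.IsWalk u (e :: l) v) :
    Γ.IsWalk u (reduceCons e l) v := by
  cases l with
  | nil => exact h
  | cons f l =>
    rw [reduceCons_cons]
    split_ifs with hf
    · have h2 : Γ.IsWalk (Γ.t f) l v := h.2.2
      rw [hf, t, Γ.inv_inv, h.1] at h2
      exact h2
    · exact h

theorem isWalk_reduce {u v : Γ.V} {l : List Γ.E} (h : Γ.IsWalk u l v) :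
    Γ.IsWalk u (reduce l) v := by
  induction l generalizing u with
  | nil => exact h
  | cons e l ih => exact isWalk_reduceCons ⟨h.1, ih h.2⟩

theorem HC.mk_congr {u v : Γ.V} {l l' : List Γ.E} (hl : l = l') (h : Γ.IsWalk u l v)
    (h' : Γ.IsWalk u l' v) : HC.mk (⟨l, h⟩ : Γ.Walk u v) = HC.mk ⟨l', h'⟩ := by
  subst hl; rfl

theorem HC.mk_reduceCons {u v : Γ.V} {e : Γ.E} {l : List Γ.E} (h : Γ.IsWalk u (e :: l) v) :
    HC.mk (⟨reduceCons e l, isWalk_reduceCons h⟩ : Γ.Walk u v) = HC.mk ⟨e :: l, h⟩ := by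
  cases l with
  | nil => rfl
  | cons f l =>
    by_cases hf : f = Γ.inv e
    · refine (Quot.sound ⟨[], l, e, ?_, ?_⟩).symm
      · simp [hf]
      · simp [reduceCons, hf]
    · exact HC.mk_congr (by simp [reduceCons, hf]) _ _

theorem HC.mk_reduce {u v : Γ.V} {l : List Γ.E} (h : Γ.IsWalk u l v) :
    HC.mk (⟨reduce l, isWalk_reduce h⟩ : Γ.Walk u v) = HC.mk ⟨l, h⟩ := by
  induction l generalizing u with
  | nil => rfl
  | cons e l ih =>
    refine (HC.mk_reduceCons (e := e) (l := reduce l) ⟨h.1, isWalk_reduce h.2⟩).trans ?_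
    exact congrArg (HC.comp (HC.mk ⟨[e], h.1, rfl⟩ : Γ.HC u (Γ.t e))) (ih h.2)

theorem sum_reduce_le {L : Γ.E → ℝ} (hL : ∀ e, 0 ≤ L e) (l : List Γ.E) :
    ((reduce l).map L).sum ≤ (l.map L).sum := by
  have key : ∀ (e : Γ.E) (l : List Γ.E), ((reduceCons e l).map L).sum ≤ L e + (l.map L).sum := by
    rintro e (_ | ⟨f, l⟩)
    · simp [reduceCons]
    · rw [reduceCons_cons]
      split_ifs
      · simp only [List.map_cons, List.sum_cons]
        linarith [hL e, hL f]
      · simp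
  induction l with
  | nil => simp [reduce]
  | cons e l ih =>
    rw [reduce_cons, List.map_cons, List.sum_cons]
    exact (key e _).trans (by linarith)

namespace HC

/-- The reduced edge-path in a homotopy class. -/
def word {u v : Γ.V} (a : Γ.HC u v) : List Γ.E :=
  Quot.lift (fun w : Γ.Walk u v => reduce w.1) (by
    rintro p q ⟨l₁, l₂, e, h, h'⟩
    rw [h, h', reduce_backtrack]) a

theorem isReduced_word {u v : Γ.V} (a : Γ.HC u v) : Γ.IsReduced a.word := by
  induction a using Quot.ind with | _ a => exact isReduced_reduce a.1

theorem isWalk_word {u v : Γ.V} (a : Γ.HC u v) : Γ.IsWalk u a.word v := by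
  induction a using Quot.ind with | _ a => exact isWalk_reduce a.2

theorem mk_word {u v : Γ.V} (a : Γ.HC u v) : mk ⟨a.word, a.isWalk_word⟩ = a := by
  induction a using Quot.ind with | _ a => exact mk_reduce a.2

theorem word_injective {u v : Γ.V} : Function.Injective (word : Γ.HC u v → List Γ.E) := by
  intro a b h
  rw [← mk_word a, ← mk_word b]
  exact mk_congr h _ _

/-- The length of the reduced edge-path in a homotopy class: the distance between the endpoints of
its lifts to the universal cover. -/
def len (L : Γ.E → ℝ) {u v : Γ.V} (a : Γ.HC u v) : ℝ := (a.word.map L).sum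

variable {L : Γ.E → ℝ}

theorem len_mk_le (hL : ∀ e, 0 ≤ L e) {u v : Γ.V} (w : Γ.Walk u v) :
    (mk w).len L ≤ w.length L := sum_reduce_le hL w.1

theorem len_nonneg (hL : ∀ e, 0 ≤ L e) {u v : Γ.V} (a : Γ.HC u v) : 0 ≤ a.len L :=
  List.sum_nonneg (by
    intro x hx
    obtain ⟨e, -, rfl⟩ := List.mem_map.1 hx
    exact hL e)

theorem len_one (u : Γ.V) : (one u : Γ.HC u u).len L = 0 := rfl

theorem len_comp_le (hL : ∀ e, 0 ≤ L e) {u v w : Γ.V} (a : Γ.HC u v) (b : Γ.HC v w) :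
    (a.comp b).len L ≤ a.len L + b.len L := by
  conv_lhs => rw [← mk_word a, ← mk_word b]
  refine (len_mk_le hL (Walk.append ⟨a.word, a.isWalk_word⟩ ⟨b.word, b.isWalk_word⟩)).trans ?_
  simp [Walk.append, Walk.length, len]

theorem len_comp_comp_le (hL : ∀ e, 0 ≤ L e) {u v w x : Γ.V} (a : Γ.HC u v) (b : Γ.HC v w)
    (c : Γ.HC w x) : ((a.comp b).comp c).len L ≤ a.len L + b.len L + c.len L :=
  (len_comp_le hL _ _).trans (by linarith [len_comp_le hL a b])

end HC

end SerreGraph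

open SerreGraph

namespace MarkedMetricGraph

variable {F : Type*} [Group F]

theorem L_nonneg (m : MarkedMetricGraph F) (e : m.Γ.E) : 0 ≤ m.L e := (m.L_pos e).le

/-- Paths in the cover project to paths in the graph of the same length, and reduction does not
increase the length, so that the lift of the reduced edge-path is a shortest path. -/
theorem d_eq_len (m : MarkedMetricGraph F) (x y : m.X.V) :
    m.d x y = (x.2.symm.comp y.2).len m.L := by
  obtain ⟨u, c⟩ := x
  obtain ⟨v, c'⟩ := y
  have lift : ∀ (l : List m.Γ.E) (h : m.Γ.IsWalk u l v) (c' : m.Γ.HC m.p v),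
      c.comp (HC.mk ⟨l, h⟩) = c' → ∃ w : m.X.Walk ⟨u, c⟩ ⟨v, c'⟩,
        w.length (liftLength m.p m.L) = (l.map m.L).sum := by
    rintro l h _ rfl
    exact exists_lift m.p m.L l u v h c
  obtain ⟨w, hw⟩ := lift _ (c.symm.comp c').isWalk_word c' (by
    rw [HC.mk_word, HC.comp_symm_cancel])
  have : Nonempty (m.X.Walk ⟨u, c⟩ ⟨v, c'⟩) := ⟨w⟩
  refine le_antisymm ((ciInf_le ⟨0, ?_⟩ w).trans_eq hw) (le_ciInf fun w' => ?_)
  · rintro _ ⟨w, rfl⟩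
    exact length_nonneg (L := liftLength m.p m.L) (fun e => m.L_pos (Sigma.fst e)) w
  · obtain ⟨q, hq, hq'⟩ := exists_proj m.p m.L w'.1 _ _ w'.2
    have h1 : c.symm.comp c' = HC.mk q := by
      rw [← show c.comp (HC.mk q) = c' from hq, HC.symm_comp_cancel]
    change HC.len m.L (c.symm.comp c') ≤ _
    rw [h1]
    exact (HC.len_mk_le m.L_nonneg q).trans_eq hq'

/-- The count of the orbit of a vertex does not involve the marking: it is the number of loops at
the projection of the vertex whose reduced representative has length at most `R`. -/
theorem orbitCount_eq (m : MarkedMetricGraph F) (x : m.X.V) (R : ℝ) :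
    m.orbitCount x R = Nat.card {g : m.Γ.HC x.1 x.1 // g.len m.L ≤ R} := by
  refine Nat.card_congr ((m.α.toEquiv.trans ⟨fun a => (x.2.symm.comp a).comp x.2,
    fun b => (x.2.comp b).comp x.2.symm, fun a => ?_, fun b => ?_⟩).subtypeEquiv fun f => ?_)
  · simp [HC.comp_assoc]
  · simp [HC.comp_assoc]
  · rw [d_eq_len]
    change HC.len m.L (x.2.symm.comp ((m.α f).comp x.2)) ≤ R ↔ _
    rw [← HC.comp_assoc]
    rfl

end MarkedMetricGraph

/-! ### Balls of homotopy classes -/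

namespace SerreGraph

variable {Γ : SerreGraph}

/-- The homotopy classes of paths from `u` to `v` whose reduced representative has length at most
`R`. -/
abbrev Ball (L : Γ.E → ℝ) (u v : Γ.V) (R : ℝ) : Type := {a : Γ.HC u v // a.len L ≤ R}

theorem exists_pos_le_length [Finite Γ.E] {L : Γ.E → ℝ} (hL : ∀ e, 0 < L e) :
    ∃ δ : ℝ, 0 < δ ∧ ∀ e, δ ≤ L e := by
  rcases isEmpty_or_nonempty Γ.E with hE | hE
  · exact ⟨1, one_pos, fun e => hE.elim e⟩
  · obtain ⟨e, he⟩ := Finite.exists_min L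
    exact ⟨L e, hL e, he⟩

theorem exists_length_le [Finite Γ.E] (L : Γ.E → ℝ) : ∃ M : ℝ, 0 ≤ M ∧ ∀ e, L e ≤ M := by
  rcases isEmpty_or_nonempty Γ.E with hE | hE
  · exact ⟨0, le_rfl, fun e => hE.elim e⟩
  · obtain ⟨e, he⟩ := Finite.exists_max L
    exact ⟨max (L e) 0, le_max_right _ _, fun e' => (he e').trans (le_max_left _ _)⟩

theorem length_mul_le_sum {L : Γ.E → ℝ} {δ : ℝ} (hδ : ∀ e, δ ≤ L e) (l : List Γ.E) :
    l.length * δ ≤ (l.map L).sum := by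
  have := List.card_nsmul_le_sum (l.map L) δ (by simpa using fun e _ => hδ e)
  simpa using this

theorem sum_le_length_mul {L : Γ.E → ℝ} {M : ℝ} (hM : ∀ e, L e ≤ M) (l : List Γ.E) :
    (l.map L).sum ≤ l.length * M := by
  have := List.sum_le_card_nsmul (l.map L) M (by simpa using fun e _ => hM e)
  simpa using this

theorem finite_ball [Finite Γ.E] {L : Γ.E → ℝ} (hL : ∀ e, 0 < L e) (u v : Γ.V) (R : ℝ) :
    Finite (Ball L u v R) := by
  obtain ⟨δ, hδ, hδL⟩ := exists_pos_le_length hL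
  obtain ⟨n, hn⟩ := exists_nat_gt (R / δ)
  have : Finite {l : List Γ.E // l.length ≤ n} := (List.finite_length_le Γ.E n).to_subtype
  refine Finite.of_injective (β := {l : List Γ.E // l.length ≤ n})
    (fun a => ⟨a.1.word, ?_⟩) fun a b h => ?_
  · have h1 := (length_mul_le_sum hδL a.1.word).trans a.2
    rw [← le_div_iff₀ hδ] at h1
    exact_mod_cast (h1.trans_lt hn).le
  · exact Subtype.ext (HC.word_injective (congrArg Subtype.val h))

theorem card_ball_mono [Finite Γ.E] {L : Γ.E → ℝ} (hL : ∀ e, 0 < L e) (u v : Γ.V) {R S : ℝ}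
    (h : R ≤ S) : Nat.card (Ball L u v R) ≤ Nat.card (Ball L u v S) := by
  have := finite_ball hL u v S
  exact Nat.card_le_card_of_injective (fun a => ⟨a.1, a.2.trans h⟩)
    fun a b h => Subtype.ext (congrArg (fun x => x.1) h)

/-- Changing the endpoints changes the radius of a ball by a bounded amount. -/
theorem card_ball_le [Finite Γ.E] {L : Γ.E → ℝ} (hL : ∀ e, 0 < L e) {u v u' v' : Γ.V}
    (a : Γ.HC u' u) (b : Γ.HC v v') (R : ℝ) :
    Nat.card (Ball L u v R) ≤ Nat.card (Ball L u' v' (R + (a.len L + b.len L))) := by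
  have := finite_ball hL u' v' (R + (a.len L + b.len L))
  refine Nat.card_le_card_of_injective (fun c => ⟨(a.comp c.1).comp b, ?_⟩) fun c c' h => ?_
  · have h1 := HC.len_comp_comp_le (fun e => (hL e).le) a c.1 b
    linarith [c.2]
  · have h1 : (a.comp c.1).comp b = (a.comp c'.1).comp b := congrArg (fun x => x.1) h
    have h2 := congrArg (fun x => (a.symm.comp x).comp b.symm) h1
    simp only [HC.comp_assoc, HC.comp_symm, HC.comp_one, HC.symm_comp_cancel] at h2
    exact Subtype.ext h2

theorem exists_hc (hΓ : Γ.Connected) (u v : Γ.V) : Nonempty (Γ.HC u v) :=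
  (hΓ u v).map HC.mk

/-- All balls of a finite connected graph have the same growth, up to a bounded change of the
radius. -/
theorem exists_card_ball_le [Finite Γ.V] [Finite Γ.E] (hΓ : Γ.Connected) {L : Γ.E → ℝ}
    (hL : ∀ e, 0 < L e) : ∃ C : ℝ, 0 ≤ C ∧ ∀ (u v u' v' : Γ.V) (R : ℝ),
      Nat.card (Ball L u v R) ≤ Nat.card (Ball L u' v' (R + C)) := by
  have c : ∀ q : Γ.V × Γ.V, Γ.HC q.1 q.2 := fun q => (exists_hc hΓ q.1 q.2).some
  obtain ⟨M, hM⟩ := (Set.finite_range fun q => (c q).len L).bddAbove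
  have hM' : ∀ q, (c q).len L ≤ M := fun q => hM ⟨q, rfl⟩
  rcases isEmpty_or_nonempty Γ.V with hV | ⟨⟨p⟩⟩
  · exact ⟨0, le_rfl, fun u => hV.elim u⟩
  have hM0 : 0 ≤ M := (HC.len_nonneg (fun e => (hL e).le) _).trans (hM' (p, p))
  refine ⟨2 * M, by linarith, fun u v u' v' R => (card_ball_le hL (c (u', u)) (c (v, v')) R).trans
    (card_ball_mono hL _ _ ?_)⟩
  linarith [hM' (u', u), hM' (v, v')]

/-- An edge-path can be cut at distance about `R` from its origin. -/
theorem exists_split {L : Γ.E → ℝ} {M : ℝ} (hM0 : 0 ≤ M) (hM : ∀ e, L e ≤ M) {S : ℝ}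
    (hS : 0 ≤ S) (l : List Γ.E) : ∀ (u v : Γ.V) (R : ℝ), 0 ≤ R → Γ.IsWalk u l v →
      (l.map L).sum ≤ R + S → ∃ (w : Γ.V) (l₁ l₂ : List Γ.E), l = l₁ ++ l₂ ∧
        Γ.IsWalk u l₁ w ∧ Γ.IsWalk w l₂ v ∧ (l₁.map L).sum ≤ R ∧ (l₂.map L).sum ≤ S + M := by
  induction l with
  | nil =>
    intro u v R hR h _
    exact ⟨u, [], [], rfl, rfl, h, by simpa using hR, by simpa using add_nonneg hS hM0⟩
  | cons e l ih =>
    intro u v R hR h hl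
    have hl' : L e + (l.map L).sum ≤ R + S := by simpa using hl
    by_cases he : L e ≤ R
    · obtain ⟨w, l₁, l₂, h1, h2, h3, h4, h5⟩ :=
        ih (Γ.t e) v (R - L e) (by linarith) h.2 (by linarith)
      refine ⟨w, e :: l₁, l₂, by rw [h1]; rfl, ⟨h.1, h2⟩, h3, ?_, h5⟩
      simp only [List.map_cons, List.sum_cons]
      linarith
    · refine ⟨u, [], e :: l, rfl, rfl, h, by simpa using hR, hl.trans ?_⟩
      linarith [hM e]

/-- The cardinalities of balls are submultiplicative, up to a bounded change of the radius. -/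
theorem exists_card_ball_add_le [Finite Γ.V] [Finite Γ.E] (hΓ : Γ.Connected) {L : Γ.E → ℝ}
    (hL : ∀ e, 0 < L e) (p : Γ.V) : ∃ C : ℝ, 0 ≤ C ∧ ∀ R S : ℝ, 0 ≤ R → 0 ≤ S →
      Nat.card (Ball L p p (R + S)) ≤
        Nat.card (Ball L p p (R + C)) * Nat.card (Ball L p p (S + C)) := by
  have hL0 : ∀ e, 0 ≤ L e := fun e => (hL e).le
  have c : ∀ v : Γ.V, Γ.HC p v := fun v => (exists_hc hΓ p v).some
  obtain ⟨D, hD⟩ := (Set.finite_range fun v => max ((c v).len L) ((c v).symm.len L)).bddAbove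
  have hD1 : ∀ v, (c v).len L ≤ D := fun v => (le_max_left _ _).trans (hD ⟨v, rfl⟩)
  have hD2 : ∀ v, (c v).symm.len L ≤ D := fun v => (le_max_right _ _).trans (hD ⟨v, rfl⟩)
  have hD0 : 0 ≤ D := (HC.len_nonneg hL0 _).trans (hD1 p)
  obtain ⟨M, hM0, hM⟩ := exists_length_le L
  refine ⟨D + M, by linarith, fun R S hR hS => ?_⟩
  have key : ∀ g : Ball L p p (R + S), ∃ x : Ball L p p (R + (D + M)) × Ball L p p (S + (D + M)),
      x.1.1.comp x.2.1 = g.1 := by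
    rintro ⟨g, hg⟩
    obtain ⟨w, l₁, l₂, h1, h2, h3, h4, h5⟩ :=
      exists_split hM0 hM hS g.word p p R hR g.isWalk_word hg
    have h6 : (HC.mk ⟨l₁, h2⟩ : Γ.HC p w).comp (HC.mk ⟨l₂, h3⟩) = g := by
      rw [← HC.mk_word g]
      exact HC.mk_congr h1.symm _ _
    refine ⟨⟨⟨(HC.mk ⟨l₁, h2⟩ : Γ.HC p w).comp (c w).symm, ?_⟩,
      ⟨(c w).comp (HC.mk ⟨l₂, h3⟩), ?_⟩⟩, ?_⟩
    · have := HC.len_comp_le hL0 (HC.mk ⟨l₁, h2⟩ : Γ.HC p w) (c w).symm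
      have h7 : (HC.mk ⟨l₁, h2⟩ : Γ.HC p w).len L ≤ R := (HC.len_mk_le hL0 _).trans h4
      linarith [hD2 w]
    · have := HC.len_comp_le hL0 (c w) (HC.mk ⟨l₂, h3⟩ : Γ.HC w p)
      have h7 : (HC.mk ⟨l₂, h3⟩ : Γ.HC w p).len L ≤ S + M := (HC.len_mk_le hL0 _).trans h5
      linarith [hD1 w]
    · refine Eq.trans ?_ h6
      simp [HC.comp_assoc]
  -- the pair of factors determines the product
  choose x hx using key
  have := finite_ball hL p p (R + (D + M))
  have := finite_ball hL p p (S + (D + M))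
  rw [← Nat.card_prod]
  refine Nat.card_le_card_of_injective x fun g g' h => Subtype.ext ?_
  rw [← hx g, ← hx g', h]

end SerreGraph

/-! ### Existence of the volume entropy -/

/-- A version of Fekete's lemma. -/
theorem exists_tendsto_log_div {N : ℝ → ℕ} {C : ℝ} (hC : 0 ≤ C) (hmono : Monotone N)
    (hpos : ∀ R, 0 ≤ R → 1 ≤ N R)
    (hadd : ∀ R S, 0 ≤ R → 0 ≤ S → N (R + S) ≤ N (R + C) * N (S + C)) :
    ∃ a, Tendsto (fun R : ℝ => Real.log (N R) / R) atTop (𝓝 a) := by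
  -- after a shift by `2 * C` the function is submultiplicative without a correction of the radius
  set M : ℝ → ℕ := fun R => N (R + 2 * C)
  have hMpos : ∀ R, 0 ≤ R → 1 ≤ M R := fun R hR => hpos _ (by linarith)
  have hMlog : ∀ R, 0 ≤ R → 0 ≤ Real.log (M R) := fun R hR =>
    Real.log_nonneg (by exact_mod_cast hMpos R hR)
  have hMmono : ∀ R S, 0 ≤ R → R ≤ S → Real.log (M R) ≤ Real.log (M S) := by
    intro R S hR hRS
    have h1 := hMpos R hR
    have h2 : M R ≤ M S := hmono (by linarith)
    gcongr
  set u : ℕ → ℝ := fun n => Real.log (M n)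
  have hu : Subadditive u := by
    intro m n
    have h1 : M ((m + n : ℕ) : ℝ) ≤ M m * M n := by
      have h2 := hadd (m + C) (n + C) (by positivity) (by positivity)
      have e1 : (m + C) + (n + C) = ((m + n : ℕ) : ℝ) + 2 * C := by push_cast; ring
      have e2 : (m + C) + C = (m : ℝ) + 2 * C := by ring
      have e3 : (n + C) + C = (n : ℝ) + 2 * C := by ring
      rwa [e1, e2, e3] at h2
    have h3 := hMpos ((m + n : ℕ) : ℝ) (by positivity)
    have h4 := hMpos m (by positivity)
    have h5 := hMpos n (by positivity)
    have h6 : (0 : ℝ) < M m := by exact_mod_cast h4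
    have h7 : (0 : ℝ) < M n := by exact_mod_cast h5
    change Real.log _ ≤ Real.log _ + Real.log _
    rw [← Real.log_mul h6.ne' h7.ne']
    refine Real.log_le_log (by exact_mod_cast h3) (by exact_mod_cast h1)
  have hlim := hu.tendsto_lim ⟨0, by
    rintro _ ⟨n, rfl⟩
    exact div_nonneg (hMlog _ (by positivity)) (by positivity)⟩
  set a := hu.lim
  have hfl : Tendsto (fun R : ℝ => ((⌊R⌋₊ : ℕ) : ℝ) / R) atTop (𝓝 1) :=
    tendsto_nat_floor_div_atTop
  have hlo : Tendsto (fun R : ℝ => u ⌊R⌋₊ / R) atTop (𝓝 a) := by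
    have h1 := (hlim.comp tendsto_nat_floor_atTop).mul hfl
    rw [mul_one] at h1
    refine h1.congr' ?_
    filter_upwards [eventually_ge_atTop 1] with R hR
    have : (⌊R⌋₊ : ℝ) ≠ 0 := by
      have := Nat.floor_pos.2 hR
      positivity
    simp only [Function.comp]
    field_simp
  have hhi : Tendsto (fun R : ℝ => u (⌊R⌋₊ + 1) / R) atTop (𝓝 a) := by
    have h0 : Tendsto (fun R : ℝ => ((⌊R⌋₊ + 1 : ℕ) : ℝ) / R) atTop (𝓝 1) := by
      have := hfl.add (tendsto_inv_atTop_zero (𝕜 := ℝ))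
      rw [add_zero] at this
      refine this.congr fun R => ?_
      push_cast
      rw [add_div, one_div]
    have h1 := ((hlim.comp (tendsto_add_atTop_nat 1)).comp tendsto_nat_floor_atTop).mul h0
    rw [mul_one] at h1
    refine h1.congr fun R => ?_
    have : ((⌊R⌋₊ + 1 : ℕ) : ℝ) ≠ 0 := by positivity
    simp only [Function.comp]
    field_simp
  have hM : Tendsto (fun R : ℝ => Real.log (M R) / R) atTop (𝓝 a) := by
    refine tendsto_of_tendsto_of_tendsto_of_le_of_le' hlo hhi ?_ ?_
    · filter_upwards [eventually_ge_atTop 0] with R hR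
      have := hMmono ⌊R⌋₊ R (by positivity) (Nat.floor_le hR)
      exact div_le_div_of_nonneg_right this hR
    · filter_upwards [eventually_ge_atTop 0] with R hR
      have := hMmono R ((⌊R⌋₊ + 1 : ℕ) : ℝ) hR (by push_cast; exact (Nat.lt_floor_add_one R).le)
      exact div_le_div_of_nonneg_right this hR
  refine ⟨a, MarkedMetricGraph.tendsto_of_le (C := 2 * C) (by linarith) hMpos hpos
    (fun R => hmono (by linarith)) (fun R => hmono (by linarith)) hM⟩

namespace MarkedMetricGraph

variable {F : Type*} [Group F]

theorem one_le_orbitCount_vertex (m : MarkedMetricGraph F) (x : m.X.V) {R : ℝ} (hR : 0 ≤ R) :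
    1 ≤ m.orbitCount x R := by
  have := m.finE
  have := finite_ball m.L_pos x.1 x.1 R
  rw [orbitCount_eq]
  have : Nonempty (Ball m.L x.1 x.1 R) := ⟨⟨HC.one _, by simpa [HC.len_one] using hR⟩⟩
  exact Nat.card_pos

/-- The limit that defines the entropy exists, for every vertex of the universal cover. -/
theorem tendsto_entropy (m : MarkedMetricGraph F) (x : m.X.V) :
    Tendsto (fun R : ℝ => Real.log (m.orbitCount x R) / R) atTop (𝓝 m.entropy) := by
  have := m.finE
  have := m.finV
  obtain ⟨C, hC, hadd⟩ := exists_card_ball_add_le m.connected m.L_pos m.p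
  obtain ⟨a, ha⟩ : ∃ a, Tendsto (fun R : ℝ => Real.log (m.orbitCount m.x₀ R) / R) atTop (𝓝 a) := by
    refine exists_tendsto_log_div hC (fun R S h => ?_) (fun R hR => m.one_le_orbitCount hR) ?_
    · rw [orbitCount_eq, orbitCount_eq]
      exact card_ball_mono m.L_pos _ _ h
    · intro R S hR hS
      simp only [orbitCount_eq]
      exact hadd R S hR hS
  rw [show m.entropy = a from ha.limUnder_eq]
  obtain ⟨D, hD, hle⟩ := exists_card_ball_le m.connected m.L_pos
  refine tendsto_of_le hD (fun R hR => m.one_le_orbitCount hR)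
    (fun R hR => m.one_le_orbitCount_vertex x hR) (fun R => ?_) (fun R => ?_) ha
  all_goals
    rw [orbitCount_eq, orbitCount_eq]
    exact hle _ _ _ _ R

end MarkedMetricGraph

/-! ### Holonomy and the Euler characteristic -/

namespace SerreGraph

variable {Γ : SerreGraph} {G : Type*} [Group G]

namespace HC

/-- The class of the path consisting of one edge. -/
def edge (e : Γ.E) : Γ.HC (Γ.o e) (Γ.t e) := mk (Walk.single e)

/-- The product of the values of a `G`-valued cochain `φ` along a homotopy class of paths. -/
def hol (φ : Γ.E → G) (hφ : ∀ e, φ (Γ.inv e) = (φ e)⁻¹) {u v : Γ.V} (a : Γ.HC u v) : G :=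
  Quot.lift (fun w : Γ.Walk u v => (w.1.map φ).prod) (by
    rintro p q ⟨l₁, l₂, e, h, h'⟩
    simp only [h, h', List.map_append, List.map_cons, List.prod_append, List.prod_cons, hφ,
      mul_inv_cancel_left]) a

theorem hol_comp {φ : Γ.E → G} (hφ : ∀ e, φ (Γ.inv e) = (φ e)⁻¹) {u v w : Γ.V} (a : Γ.HC u v)
    (b : Γ.HC v w) : (a.comp b).hol φ hφ = a.hol φ hφ * b.hol φ hφ := by
  induction a using Quot.ind with | _ a => ?_
  induction b using Quot.ind with | _ b => ?_
  change ((a.1 ++ b.1).map φ).prod = (a.1.map φ).prod * (b.1.map φ).prod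
  rw [List.map_append, List.prod_append]

theorem hol_one {φ : Γ.E → G} (hφ : ∀ e, φ (Γ.inv e) = (φ e)⁻¹) (u : Γ.V) :
    (one u : Γ.HC u u).hol φ hφ = 1 := rfl

theorem hol_edge {φ : Γ.E → G} (hφ : ∀ e, φ (Γ.inv e) = (φ e)⁻¹) (e : Γ.E) :
    (edge e).hol φ hφ = φ e := List.prod_singleton

theorem hol_symm {φ : Γ.E → G} (hφ : ∀ e, φ (Γ.inv e) = (φ e)⁻¹) {u v : Γ.V} (a : Γ.HC u v) :
    a.symm.hol φ hφ = (a.hol φ hφ)⁻¹ := by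
  rw [eq_inv_iff_mul_eq_one, ← hol_comp, symm_comp, hol_one]

/-- The holonomy as a homomorphism on the fundamental group. -/
def holHom (φ : Γ.E → G) (hφ : ∀ e, φ (Γ.inv e) = (φ e)⁻¹) (p : Γ.V) : Γ.Pi1 p →* G where
  toFun a := a.hol φ hφ
  map_one' := rfl
  map_mul' a b := hol_comp hφ a b

theorem functor_one (Φ : ∀ u v : Γ.V, Γ.HC u v → G)
    (hΦ : ∀ (u v w : Γ.V) (a : Γ.HC u v) (b : Γ.HC v w), Φ u w (a.comp b) = Φ u v a * Φ v w b)
    (u : Γ.V) : Φ u u (one u) = 1 := by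
  have := hΦ u u u (one u) (one u)
  rwa [one_comp, left_eq_mul] at this

theorem functor_inv (Φ : ∀ u v : Γ.V, Γ.HC u v → G)
    (hΦ : ∀ (u v w : Γ.V) (a : Γ.HC u v) (b : Γ.HC v w), Φ u w (a.comp b) = Φ u v a * Φ v w b)
    (e : Γ.E) :
    Φ _ _ (edge (Γ.inv e)) = (Φ _ _ (edge e))⁻¹ := by
  have key : ∀ (u v : Γ.V) (h : Γ.IsWalk u [Γ.inv e] v),
      Φ u v (mk ⟨[Γ.inv e], h⟩) = Φ _ _ (edge (Γ.inv e)) := by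
    rintro u v ⟨rfl, rfl⟩
    rfl
  have h : Γ.IsWalk (Γ.t e) [Γ.inv e] (Γ.o e) := ⟨rfl, congrArg Γ.o (Γ.inv_inv e)⟩
  rw [← key _ _ h, eq_inv_iff_mul_eq_one, ← hΦ]
  exact (congrArg (Φ _ _) (symm_comp (edge e))).trans (functor_one Φ hΦ _)

/-- A functor from the fundamental groupoid to a group is the holonomy of its values on edges. -/
theorem hol_eq_functor (Φ : ∀ u v : Γ.V, Γ.HC u v → G)
    (hΦ : ∀ (u v w : Γ.V) (a : Γ.HC u v) (b : Γ.HC v w), Φ u w (a.comp b) = Φ u v a * Φ v w b)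
    {φ : Γ.E → G} (hφ : ∀ e, φ (Γ.inv e) = (φ e)⁻¹)
    (h : ∀ e, Φ _ _ (edge e) = φ e) {u v : Γ.V} (a : Γ.HC u v) : a.hol φ hφ = Φ u v a := by
  induction a using Quot.ind with | _ a => ?_
  obtain ⟨l, hl⟩ := a
  induction l generalizing u with
  | nil =>
    cases hl
    exact (functor_one Φ hΦ _).symm
  | cons e l ih =>
    obtain ⟨rfl, h2⟩ := hl
    have h3 := ih h2
    change hol φ hφ ((edge e).comp (mk ⟨l, h2⟩)) = Φ _ _ ((edge e).comp (mk ⟨l, h2⟩))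
    rw [hol_comp, hol_edge, hΦ, h]
    exact congrArg _ h3

end HC

/-- The `G`-valued cochains: the functions on oriented edges that are odd under reversal. -/
abbrev Cochain (Γ : SerreGraph) (G : Type*) [Group G] : Type _ :=
  {φ : Γ.E → G // ∀ e, φ (Γ.inv e) = (φ e)⁻¹}

/-- One of the two orientations can be chosen for every non-oriented edge. -/
theorem exists_orientation (Γ : SerreGraph) [Finite Γ.E] :
    ∃ P : Γ.E → Prop, ∀ e, P (Γ.inv e) ↔ ¬ P e := by
  obtain ⟨n, ⟨f⟩⟩ := Finite.exists_equiv_fin Γ.E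
  refine ⟨fun e => f e < f (Γ.inv e), fun e => ?_⟩
  have : f (Γ.inv e) ≠ f e := fun h => Γ.inv_ne e (f.injective h)
  simp only [Γ.inv_inv]
  omega

theorem card_cochain [Finite Γ.E] :
    ∃ n, Nat.card Γ.E = 2 * n ∧ Nat.card (Γ.Cochain G) = Nat.card G ^ n := by
  classical
  obtain ⟨P, hP⟩ := exists_orientation Γ
  refine ⟨Nat.card {e // P e}, ?_, ?_⟩
  · rw [← Nat.card_congr (Equiv.sumCompl P), Nat.card_sum, two_mul]
    congr 1
    refine Nat.card_congr ⟨fun e => ⟨Γ.inv e.1, ?_⟩, fun e => ⟨Γ.inv e.1, ?_⟩, fun e => ?_,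
      fun e => ?_⟩
    · exact (hP _).2 e.2
    · exact fun h => (hP _).1 h e.2
    · exact Subtype.ext (Γ.inv_inv _)
    · exact Subtype.ext (Γ.inv_inv _)
  · rw [← Nat.card_fun]
    refine Nat.card_congr ⟨fun φ e => φ.1 e.1, fun g => ⟨fun e => if h : P e then g ⟨e, h⟩ else
      (g ⟨Γ.inv e, (hP e).2 h⟩)⁻¹, fun e => ?_⟩, fun φ => Subtype.ext (funext fun e => ?_),
      fun g => funext fun e => ?_⟩
    · by_cases h : P e
      · have h' : ¬ P (Γ.inv e) := fun h' => (hP e).1 h' h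
        simp [h, h', Γ.inv_inv]
      · have h' : P (Γ.inv e) := (hP e).2 h
        simp [h, h']
    · by_cases h : P e
      · simp [h]
      · simp [h, φ.2]
    · simp [e.2]

/-- For an abelian group, a cochain is determined by its holonomies around the loops at `p` and
along fixed paths from `p` to the other vertices, and these can be prescribed. -/
theorem card_cochain_eq {A : Type*} [CommGroup A] [Finite Γ.V] (hΓ : Γ.Connected) (p : Γ.V) :
    Nat.card (Γ.Cochain A) = Nat.card (Γ.Pi1 p →* A) * Nat.card A ^ (Nat.card Γ.V - 1) := by
  classical
  obtain ⟨c, hc⟩ : ∃ c : ∀ v, Γ.HC p v, c p = HC.one p := by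
    have c : ∀ v : Γ.V, Γ.HC p v := fun v => (exists_hc hΓ p v).some
    exact ⟨fun v => (c p).symm.comp (c v), HC.symm_comp _⟩
  have hcard : Nat.card {v : Γ.V // v ≠ p} = Nat.card Γ.V - 1 := by
    have := Fintype.ofFinite Γ.V
    simp [Nat.card_eq_fintype_card, Fintype.card_subtype_compl]
  -- the pair of the holonomy homomorphism and of the holonomies along the paths `c v`, `v ≠ p`
  rw [← hcard, ← Nat.card_fun, ← Nat.card_prod]
  refine Nat.card_congr (Equiv.ofBijective
    (fun φ => (HC.holHom φ.1 φ.2 p, fun v => (c v.1).hol φ.1 φ.2)) ⟨?_, ?_⟩)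
  · rintro ⟨φ, hφ⟩ ⟨φ', hφ'⟩ h
    simp only [Prod.mk.injEq] at h
    have h1 : ∀ a : Γ.HC p p, a.hol φ hφ = a.hol φ' hφ' := fun a => DFunLike.congr_fun h.1 a
    have h2 : ∀ v, (c v).hol φ hφ = (c v).hol φ' hφ' := by
      intro v
      by_cases hv : v = p
      · exact hv ▸ h1 (c p)
      · exact congrFun h.2 ⟨v, hv⟩
    refine Subtype.ext (funext fun e => ?_)
    have h3 := h1 (((c _).comp (HC.edge e)).comp (c _).symm)
    simp only [HC.hol_comp, HC.hol_symm, HC.hol_edge, h2] at h3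
    exact mul_left_cancel (mul_right_cancel h3)
  · rintro ⟨ψ, f⟩
    -- the cochain sought is the restriction to edges of the functor `Φ`
    let f' : Γ.V → A := fun v => if h : v = p then 1 else f ⟨v, h⟩
    have hf'p : f' p = 1 := dif_pos rfl
    let Φ : ∀ u v : Γ.V, Γ.HC u v → A := fun u v a =>
      (f' u)⁻¹ * ψ (((c u).comp a).comp (c v).symm) * f' v
    have hΦ : ∀ (u v w : Γ.V) (a : Γ.HC u v) (b : Γ.HC v w),
        Φ u w (a.comp b) = Φ u v a * Φ v w b := by
      intro u v w a b
      have h1 : ((c u).comp (a.comp b)).comp (c w).symm =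
          (((c u).comp a).comp (c v).symm : Γ.HC p p) *
            (((c v).comp b).comp (c w).symm : Γ.HC p p) := by
        change _ = (((c u).comp a).comp (c v).symm).comp (((c v).comp b).comp (c w).symm)
        simp [HC.comp_assoc]
      simp only [Φ]
      rw [h1, map_mul]
      group
    have hφ := HC.functor_inv Φ hΦ
    refine ⟨⟨fun e => Φ _ _ (HC.edge e), hφ⟩, Prod.ext (MonoidHom.ext fun a => ?_)
      (funext fun v => ?_)⟩
    · refine (HC.hol_eq_functor Φ hΦ hφ (fun _ => rfl) a).trans ?_
      simp only [Φ, hf'p, hc, HC.one_comp, inv_one, one_mul, mul_one]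
      rw [show (HC.one p).symm = HC.one p from rfl, HC.comp_one]
    · refine (HC.hol_eq_functor Φ hΦ hφ (fun _ => rfl) (c v.1)).trans ?_
      have h1 : ψ (HC.one p) = 1 := map_one ψ
      simp only [Φ, hf'p, hc, HC.one_comp, HC.comp_symm, h1, inv_one, one_mul]
      exact dif_neg v.2

theorem sum_degree [Fintype Γ.V] [Finite Γ.E] : ∑ v, Γ.degree v = Nat.card Γ.E := by
  rw [← Nat.card_congr (Equiv.sigmaFiberEquiv Γ.o), Nat.card_sigma]
  rfl

end SerreGraph

namespace MarkedMetricGraph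

variable {F : Type*} [Group F]

/-- The Euler characteristic of a finite connected graph whose fundamental group is free of rank
`k` is `1 - k`; the proof counts the `ℤˣ`-valued cochains. -/
theorem card_edges_eq (m : MarkedMetricGraph F) {k : ℕ} (b : FreeGroupBasis (Fin k) F) :
    Nat.card m.Γ.E + 2 = 2 * (k + Nat.card m.Γ.V) := by
  have := m.finE
  have := m.finV
  have hA : Nat.card ℤˣ = 2 := by simp
  obtain ⟨n, hn, hn'⟩ := card_cochain (Γ := m.Γ) (G := ℤˣ)
  have h1 := card_cochain_eq (A := ℤˣ) m.connected m.p
  have h2 : Nat.card (m.Γ.Pi1 m.p →* ℤˣ) = 2 ^ k := by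
    rw [← hA]
    conv_rhs => rw [← Nat.card_fin k]
    rw [← Nat.card_fun]
    refine Nat.card_congr (Equiv.trans ⟨fun ψ => ψ.comp m.α.toMonoidHom,
      fun ψ => ψ.comp m.α.symm.toMonoidHom, fun ψ => ?_, fun ψ => ?_⟩ b.lift.symm)
    · ext; simp
    · ext; simp
  rw [hn', h2, hA, ← pow_add] at h1
  have h3 := Nat.pow_right_injective le_rfl h1
  have h4 : 0 < Nat.card m.Γ.V := Nat.card_pos_iff.2 ⟨⟨m.p⟩, inferInstance⟩
  omega

end MarkedMetricGraph

/-! ### Auxiliary inequalities -/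

/-- Jensen's inequality for the logarithm and the uniform weights. -/
theorem log_card_add_le_log_sum {ι : Type*} {s : Finset ι} (hs : s.Nonempty) {z : ι → ℝ}
    (hz : ∀ i ∈ s, 0 < z i) :
    Real.log s.card + ∑ i ∈ s, Real.log (z i) / s.card ≤ Real.log (∑ i ∈ s, z i) := by
  have hc : (0 : ℝ) < s.card := by exact_mod_cast hs.card_pos
  have h := strictConcaveOn_log_Ioi.concaveOn.le_map_sum (t := s) (w := fun _ => (s.card : ℝ)⁻¹)
    (p := z) (fun _ _ => by positivity) (by simp [hc.ne']) hz
  simp only [smul_eq_mul] at h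
  rw [← Finset.mul_sum, ← Finset.mul_sum,
    Real.log_mul (inv_ne_zero hc.ne') (Finset.sum_pos hz hs).ne', Real.log_inv] at h
  rw [← Finset.sum_div, div_eq_inv_mul]
  linarith

theorem not_forall_exp_le_linear {A b c : ℝ} (hc : 0 < c) :
    ¬ ∀ n : ℕ, Real.exp (b + c * n) ≤ A * (n + 1) := by
  intro h
  have hr : |Real.exp (-c)| < 1 := by
    rw [abs_of_pos (Real.exp_pos _)]
    simpa using hc
  have h1 := tendsto_pow_const_mul_const_pow_of_abs_lt_one 1 hr
  have h2 := tendsto_pow_const_mul_const_pow_of_abs_lt_one 0 hr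
  have h3 := (h1.add h2).const_mul A
  have h4 : Real.exp b ≤ A * (0 + 0) := by
    refine ge_of_tendsto' h3 fun n => ?_
    have h5 := mul_le_mul_of_nonneg_right (h n) (Real.exp_pos (-c * n)).le
    rw [← Real.exp_add] at h5
    have e1 : b + c * n + -c * n = b := by ring
    have e2 : Real.exp (-c) ^ n = Real.exp (-c * n) := by
      rw [← Real.exp_nat_mul]; ring_nf
    rw [e1] at h5
    rw [e2]
    refine h5.trans_eq (by ring)
  have := Real.exp_pos b
  linarith

/-- Among the degrees `d ≥ 3`, the ratio of `d * log (d - 1)` to `d - 2` is smallest for `d = 3`. -/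
theorem three_mul_log_two_mul_le {d : ℕ} (hd : 3 ≤ d) :
    3 * Real.log 2 * ((d : ℝ) - 2) ≤ d * Real.log ((d : ℝ) - 1) := by
  obtain ⟨j, rfl⟩ := Nat.exists_eq_add_of_le hd
  have key : 8 ^ (j + 1) ≤ (j + 2) ^ (j + 3) := by
    rcases lt_or_ge j 6 with h | h
    · interval_cases j <;> norm_num
    · calc 8 ^ (j + 1) ≤ 8 ^ (j + 3) := Nat.pow_le_pow_right (by norm_num) (by omega)
        _ ≤ (j + 2) ^ (j + 3) := Nat.pow_le_pow_left (by omega) _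
  have h1 : Real.log ((8 : ℝ) ^ (j + 1)) ≤ Real.log (((j : ℝ) + 2) ^ (j + 3)) :=
    Real.log_le_log (by positivity) (by exact_mod_cast key)
  rw [Real.log_pow, Real.log_pow, show (8 : ℝ) = 2 ^ 3 by norm_num, Real.log_pow] at h1
  push_cast at h1 ⊢
  have e1 : (3 : ℝ) + j - 1 = j + 2 := by ring
  rw [e1]
  linarith

/-! ### Weighted sums over reduced edge-paths -/

namespace SerreGraph

variable {Γ : SerreGraph} [Fintype Γ.E]

open Classical in
/-- The edges that may follow `e` in a reduced edge-path. -/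
def succs (e : Γ.E) : Finset Γ.E := {f | Γ.o f = Γ.t e ∧ f ≠ Γ.inv e}

@[simp] theorem mem_succs {e f : Γ.E} : f ∈ succs e ↔ Γ.o f = Γ.t e ∧ f ≠ Γ.inv e := by
  simp [succs]

theorem mem_succs_inv {e f : Γ.E} : Γ.inv e ∈ succs (Γ.inv f) ↔ f ∈ succs e := by
  simp only [mem_succs, t, Γ.inv_inv, ne_eq]
  rw [eq_comm (a := Γ.o (Γ.inv e)), eq_comm (a := Γ.inv e)]

theorem card_succs (e : Γ.E) : (succs e).card = Γ.degree (Γ.t e) - 1 := by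
  classical
  have h : succs e = (Finset.univ.filter fun f => Γ.o f = Γ.t e).erase (Γ.inv e) := by
    ext f
    simp [and_comm]
  have hmem : Γ.inv e ∈ Finset.univ.filter fun f => Γ.o f = Γ.t e :=
    Finset.mem_filter.2 ⟨Finset.mem_univ _, rfl⟩
  rw [h, Finset.card_erase_of_mem hmem, degree, Nat.card_eq_fintype_card,
    Fintype.card_subtype]

open Classical in
/-- The reduced edge-paths with first edge `e` and `n + 1` edges. -/
def paths : ℕ → Γ.E → Finset (List Γ.E)
  | 0, e => {[e]}
  | n + 1, e => ((succs e).biUnion (paths n)).image (List.cons e)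

theorem mem_paths {n : ℕ} {e : Γ.E} {l : List Γ.E} : l ∈ paths n e ↔
    ∃ l', l = e :: l' ∧ l'.length = n ∧ Γ.IsReduced (e :: l') ∧ ∃ v, Γ.IsWalk (Γ.t e) l' v := by
  classical
  induction n generalizing e l with
  | zero =>
    simp only [paths, Finset.mem_singleton]
    constructor
    · rintro rfl
      exact ⟨[], rfl, rfl, trivial, _, rfl⟩
    · rintro ⟨l', rfl, h, -⟩
      rw [List.length_eq_zero_iff.1 h]
  | succ n ih =>
    simp only [paths, Finset.mem_image, Finset.mem_biUnion, ih]
    constructor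
    · rintro ⟨_, ⟨f, hf, l', rfl, h1, h2, v, h3⟩, rfl⟩
      rw [mem_succs] at hf
      exact ⟨f :: l', rfl, by simp [h1], ⟨hf.2, h2⟩, v, hf.1, h3⟩
    · rintro ⟨_ | ⟨f, l'⟩, rfl, h1, h2, v, h3⟩
      · simp at h1
      · exact ⟨f :: l', ⟨f, mem_succs.2 ⟨h3.1, h2.1⟩, l', rfl, by simpa using h1, h2.2, v, h3.2⟩,
          rfl⟩

/-- The sum over the reduced edge-paths with first edge `e` and `n + 1` edges of the products of
the weights `x` of their edges. -/
def pathSum (x : Γ.E → ℝ) : ℕ → Γ.E → ℝ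
  | 0, e => x e
  | n + 1, e => x e * ∑ f ∈ succs e, pathSum x n f

theorem sum_paths (x : Γ.E → ℝ) (n : ℕ) (e : Γ.E) :
    ∑ l ∈ paths n e, (l.map x).prod = pathSum x n e := by
  classical
  induction n generalizing e with
  | zero => simp [paths, pathSum]
  | succ n ih =>
    rw [paths, Finset.sum_image (fun a _ b _ h => List.cons_injective h), pathSum,
      Finset.sum_biUnion, Finset.mul_sum]
    · refine Finset.sum_congr rfl fun f _ => ?_
      rw [← ih, Finset.mul_sum]
      simp
    · intro f _ f' _ hff'
      refine Finset.disjoint_left.2 fun l hl hl' => hff' ?_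
      obtain ⟨a, rfl, -⟩ := mem_paths.1 hl
      obtain ⟨b, hb, -⟩ := mem_paths.1 hl'
      exact (List.cons.inj hb).1

theorem pathSum_pos {x : Γ.E → ℝ} (hx : ∀ e, 0 < x e) (hq : ∀ e : Γ.E, (succs e).Nonempty)
    (n : ℕ) (e : Γ.E) : 0 < pathSum x n e := by
  induction n generalizing e with
  | zero => exact hx e
  | succ n ih => exact mul_pos (hx e) (Finset.sum_pos (fun f _ => ih f) (hq e))

/-- The uniform measure on oriented edges is stationary for the random walk without back-tracking:
it is invariant under averaging over the successors. -/
theorem sum_sum_succs_div (hq : ∀ e : Γ.E, (succs e).Nonempty) (g : Γ.E → ℝ) :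
    ∑ e, ∑ f ∈ succs e, g f / (succs e).card = ∑ f, g f := by
  classical
  have hinv : ∀ f : Γ.E, (Finset.univ.filter fun e => f ∈ succs e).card =
      (succs (Γ.inv f)).card := by
    intro f
    refine Finset.card_bij (fun e _ => Γ.inv e) (fun e he => ?_) (fun e _ e' _ h => ?_)
      fun e he => ⟨Γ.inv e, ?_, Γ.inv_inv e⟩
    · exact mem_succs_inv.2 (Finset.mem_filter.1 he).2
    · rw [← Γ.inv_inv e, h, Γ.inv_inv]
    · rw [Finset.mem_filter, ← mem_succs_inv, Γ.inv_inv]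
      exact ⟨Finset.mem_univ _, he⟩
  have hcard : ∀ e f : Γ.E, f ∈ succs e → (succs e).card = (succs (Γ.inv f)).card := by
    intro e f hf
    rw [card_succs, card_succs, t, t, Γ.inv_inv, (mem_succs.1 hf).1, t]
  calc ∑ e, ∑ f ∈ succs e, g f / (succs e).card
      = ∑ e, ∑ f, if f ∈ succs e then g f / (succs (Γ.inv f)).card else 0 := by
        refine Finset.sum_congr rfl fun e _ => ?_
        rw [← Finset.sum_filter]
        refine Finset.sum_congr (by ext; simp) fun f hf => ?_
        rw [hcard e f (by simpa using hf)]
    _ = ∑ f, g f := by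
        rw [Finset.sum_comm]
        refine Finset.sum_congr rfl fun f _ => ?_
        rw [← Finset.sum_filter, Finset.sum_const, hinv, nsmul_eq_mul]
        have : ((succs (Γ.inv f)).card : ℝ) ≠ 0 := by exact_mod_cast (hq _).card_pos.ne'
        field_simp

/-- By Jensen's inequality, the sum of the logarithms of the weighted sums grows at least linearly,
at the rate given by the entropy of the random walk without back-tracking. -/
theorem sum_log_pathSum_ge {x : Γ.E → ℝ} (hx : ∀ e, 0 < x e)
    (hq : ∀ e : Γ.E, (succs e).Nonempty) (n : ℕ) :
    ∑ e, Real.log (x e) + n * ∑ e, (Real.log (succs e).card + Real.log (x e)) ≤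
      ∑ e, Real.log (pathSum x n e) := by
  induction n with
  | zero => simp [pathSum]
  | succ n ih =>
    have hpos := pathSum_pos hx hq n
    have h1 : ∑ e, (Real.log (succs e).card + Real.log (x e)) +
        ∑ e, Real.log (pathSum x n e) ≤ ∑ e, Real.log (pathSum x (n + 1) e) := by
      rw [← sum_sum_succs_div hq fun f => Real.log (pathSum x n f), ← Finset.sum_add_distrib]
      refine Finset.sum_le_sum fun e _ => ?_
      rw [pathSum, Real.log_mul (hx e).ne' (Finset.sum_pos (fun f _ => hpos f) (hq e)).ne']
      linarith [log_card_add_le_log_sum (hq e) (z := pathSum x n) fun f _ => hpos f]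
    push_cast
    linarith

/-- An exponential bound for the growth of balls bounds the sums of `exp (-s * length)` over
reduced edge-paths. -/
theorem exists_pathSum_le [Finite Γ.V] {L : Γ.E → ℝ} (hL : ∀ e, 0 < L e) {s K : ℝ} (hs : 0 ≤ s)
    (hK : ∀ (u v : Γ.V) (R : ℝ), 0 ≤ R → (Nat.card (Ball L u v R) : ℝ) ≤ K * Real.exp (s * R)) :
    ∃ A : ℝ, ∀ (n : ℕ) (e : Γ.E), pathSum (fun e => Real.exp (-(s * L e))) n e ≤ A * (n + 1) := by
  classical
  have := Fintype.ofFinite Γ.V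
  obtain ⟨M, hM0, hM⟩ := exists_length_le L
  have hprod : ∀ l : List Γ.E,
      (l.map fun e => Real.exp (-(s * L e))).prod = Real.exp (-(s * (l.map L).sum)) := by
    intro l
    induction l with
    | nil => simp
    | cons e l ih =>
      rw [List.map_cons, List.prod_cons, ih, List.map_cons, List.sum_cons, ← Real.exp_add]
      ring_nf
  set B : ℝ := Fintype.card Γ.V * (K * Real.exp s) with hB
  have hB0 : 0 ≤ B := by
    rcases isEmpty_or_nonempty Γ.V with hV | ⟨⟨p⟩⟩
    · simp [hB]
    · have := (Nat.cast_nonneg (α := ℝ) _).trans (hK p p 0 le_rfl)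
      have hK0 : 0 ≤ K := by simpa using this
      positivity
  -- the edge-paths whose length has integral part `j`: the growth of the balls and the decay of
  -- the weights cancel, so that their contribution is bounded independently of `j`
  have hfiber : ∀ (n j : ℕ) (e : Γ.E), ∑ l ∈ paths n e with ⌊(l.map L).sum⌋₊ = j,
      Real.exp (-(s * (l.map L).sum)) ≤ B := by
    intro n j e
    have hfin : ∀ v, Finite (Ball L (Γ.o e) v (j + 1)) := fun v => finite_ball hL _ _ _
    have := Fintype.ofFinite (Σ v, Ball L (Γ.o e) v (j + 1))
    have hlen : ∀ l : List Γ.E, 0 ≤ (l.map L).sum := fun l => List.sum_nonneg (by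
      intro x hx
      obtain ⟨e, -, rfl⟩ := List.mem_map.1 hx
      exact (hL e).le)
    have hsub : ((paths n e).filter fun l => ⌊(l.map L).sum⌋₊ = j) ⊆
        Finset.univ.image fun a : Σ v, Ball L (Γ.o e) v (j + 1) => a.2.1.word := by
      intro l hl
      rw [Finset.mem_filter] at hl
      obtain ⟨⟨l', rfl, -, hred, v, hw⟩, hj⟩ := And.imp_left mem_paths.1 hl
      have hword : HC.word (HC.mk (⟨e :: l', rfl, hw⟩ : Γ.Walk (Γ.o e) v)) = e :: l' :=
        hred.reduce_eq
      refine Finset.mem_image.2 ⟨⟨v, HC.mk ⟨e :: l', rfl, hw⟩, ?_⟩, Finset.mem_univ _, hword⟩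
      rw [HC.len, hword, ← hj]
      exact (Nat.lt_floor_add_one _).le
    have hcard : (((paths n e).filter fun l => ⌊(l.map L).sum⌋₊ = j).card : ℝ) ≤
        Fintype.card Γ.V * (K * Real.exp (s * (j + 1))) := by
      have h1 := (Finset.card_le_card hsub).trans Finset.card_image_le
      rw [Finset.card_univ, ← Nat.card_eq_fintype_card, Nat.card_sigma] at h1
      have h2 : ((∑ v, Nat.card (Ball L (Γ.o e) v (j + 1)) : ℕ) : ℝ) ≤
          ∑ _v : Γ.V, K * Real.exp (s * (j + 1)) := by
        push_cast
        exact Finset.sum_le_sum fun v _ => hK _ _ _ (by positivity)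
      rw [Finset.sum_const, Finset.card_univ, nsmul_eq_mul] at h2
      exact (Nat.cast_le.2 h1).trans h2
    have hterm : ∀ l ∈ (paths n e).filter fun l => ⌊(l.map L).sum⌋₊ = j,
        Real.exp (-(s * (l.map L).sum)) ≤ Real.exp (-(s * j)) := by
      intro l hl
      have h1 : (j : ℝ) ≤ (l.map L).sum := by
        rw [← (Finset.mem_filter.1 hl).2]
        exact Nat.floor_le (hlen l)
      exact Real.exp_le_exp.2 (neg_le_neg (mul_le_mul_of_nonneg_left h1 hs))
    refine (Finset.sum_le_card_nsmul _ _ _ hterm).trans ?_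
    rw [nsmul_eq_mul]
    refine (mul_le_mul_of_nonneg_right hcard (Real.exp_pos _).le).trans_eq ?_
    rw [hB, mul_assoc, mul_assoc, ← Real.exp_add]
    ring_nf
  refine ⟨(M + 1) * B, fun n e => ?_⟩
  rw [← sum_paths]
  simp only [hprod]
  rw [← Finset.sum_fiberwise_of_maps_to (t := Finset.range (⌊(n + 1) * M⌋₊ + 1))
    (g := fun l : List Γ.E => ⌊(l.map L).sum⌋₊)]
  · refine (Finset.sum_le_card_nsmul _ _ _ fun j _ => hfiber n j e).trans ?_
    rw [Finset.card_range, nsmul_eq_mul]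
    have h1 : (⌊(n + 1) * M⌋₊ : ℝ) ≤ (n + 1) * M := Nat.floor_le (by positivity)
    have h2 : ((⌊(n + 1) * M⌋₊ + 1 : ℕ) : ℝ) ≤ (M + 1) * (n + 1) := by
      push_cast
      nlinarith [Nat.cast_nonneg (α := ℝ) n]
    calc _ ≤ (M + 1) * (n + 1) * B := mul_le_mul_of_nonneg_right h2 hB0
      _ = _ := by ring
  · intro l hl
    obtain ⟨l', rfl, hlen, -⟩ := mem_paths.1 hl
    have h1 := sum_le_length_mul hM (e :: l')
    rw [List.length_cons, hlen] at h1
    push_cast at h1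
    exact Finset.mem_range.2 (Nat.lt_succ_of_le (Nat.floor_le_floor h1))

/-- Every vertex `v` is the terminus of `degree v` oriented edges. -/
theorem sum_comp_terminus {Γ : SerreGraph} [Fintype Γ.V] [Fintype Γ.E] (g : Γ.V → ℝ) :
    ∑ e, g (Γ.t e) = ∑ v, Γ.degree v * g v := by
  classical
  have h1 : ∑ e, g (Γ.t e) = ∑ e, g (Γ.o e) :=
    Fintype.sum_equiv ⟨Γ.inv, Γ.inv, Γ.inv_inv, Γ.inv_inv⟩ _ _ fun e => rfl
  rw [h1, ← Finset.sum_fiberwise Finset.univ Γ.o]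
  refine Finset.sum_congr rfl fun v _ => ?_
  rw [Finset.sum_congr rfl (g := fun _ => g v) fun e he => by rw [(Finset.mem_filter.1 he).2],
    Finset.sum_const, nsmul_eq_mul, degree, Nat.card_eq_fintype_card, Fintype.card_subtype]

end SerreGraph

/-! ### Lower and upper bounds for the volume entropy -/

namespace MarkedMetricGraph

variable {F : Type*} [Group F]

/-- The entropy of the random walk without back-tracking, divided by the mean length of an edge,
bounds the volume entropy from below. -/
theorem sum_log_div_le_entropy (m : MarkedMetricGraph F) [Fintype m.Γ.E] [Nonempty m.Γ.E]
    (hdeg : ∀ v, 3 ≤ m.Γ.degree v) :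
    (∑ e, Real.log (m.Γ.degree (m.Γ.t e) - 1)) / ∑ e, m.L e ≤ m.entropy := by
  have := m.finV
  have hcard : ∀ e : m.Γ.E, ((succs e).card : ℝ) = m.Γ.degree (m.Γ.t e) - 1 := fun e => by
    rw [card_succs, Nat.cast_sub ((by norm_num : 1 ≤ 3).trans (hdeg _)), Nat.cast_one]
  have hq : ∀ e : m.Γ.E, (succs e).Nonempty := fun e => by
    rw [← Finset.card_pos, card_succs]
    have := hdeg (m.Γ.t e)
    omega
  have hW : 0 < ∑ e, m.L e := Finset.sum_pos (fun e _ => m.L_pos e) Finset.univ_nonempty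
  have hH : 0 < ∑ e, Real.log (m.Γ.degree (m.Γ.t e) - 1) := by
    refine Finset.sum_pos (fun e _ => Real.log_pos ?_) Finset.univ_nonempty
    have : (3 : ℝ) ≤ m.Γ.degree (m.Γ.t e) := by exact_mod_cast hdeg _
    linarith
  by_contra! hlt
  -- for such `s` the weighted sums would both grow exponentially and be at most linear
  obtain ⟨s, hs1, hs2⟩ := exists_between (max_lt hlt (div_pos hH hW))
  rw [max_lt_iff] at hs1
  obtain ⟨hs, hs0⟩ := hs1
  rw [lt_div_iff₀ hW] at hs2
  have hev := (m.tendsto_entropy m.x₀).eventually (gt_mem_nhds hs)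
  obtain ⟨R₀, hR₀⟩ := eventually_atTop.1 (hev.and (eventually_gt_atTop 0))
  obtain ⟨C, hC, hle⟩ := exists_card_ball_le m.connected m.L_pos
  have hR₀0 : 0 < R₀ := (hR₀ R₀ le_rfl).2
  obtain ⟨A, hA⟩ := exists_pathSum_le m.L_pos (K := Real.exp (s * (C + R₀))) hs0.le (by
    intro u v R hR
    have h1 : Nat.card (Ball m.L u v R) ≤ m.orbitCount m.x₀ (R + (C + R₀)) := by
      rw [orbitCount_eq, ← add_assoc]
      exact (hle u v _ _ R).trans (card_ball_mono m.L_pos _ _ (by linarith))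
    have h2 := (hR₀ (R + (C + R₀)) (by linarith)).1
    rw [div_lt_iff₀ (by linarith), Real.log_lt_iff_lt_exp (by
      have := m.one_le_orbitCount (R := R + (C + R₀)) (by linarith)
      exact_mod_cast this)] at h2
    rw [← Real.exp_add]
    refine (Nat.cast_le.2 h1).trans (h2.le.trans_eq ?_)
    ring_nf)
  set x : m.Γ.E → ℝ := fun e => Real.exp (-(s * m.L e)) with hx
  set κ : ℝ := ∑ e, (Real.log (succs e).card + Real.log (x e)) with hκ
  have hκ0 : 0 < κ := by
    simp only [hκ, hx, Real.log_exp, hcard, Finset.sum_add_distrib, Finset.sum_neg_distrib,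
      ← Finset.mul_sum]
    linarith
  set N : ℝ := (Fintype.card m.Γ.E : ℝ)
  have hN : 0 < N := by
    exact Nat.cast_pos.2 Fintype.card_pos
  refine not_forall_exp_le_linear (A := A) (b := (∑ e, Real.log (x e)) / N) (div_pos hκ0 hN)
    fun n => ?_
  have h1 := sum_log_pathSum_ge (fun e => Real.exp_pos (-(s * m.L e))) hq n
  obtain ⟨e, -, he⟩ := Finset.exists_le_of_sum_le (s := (Finset.univ : Finset m.Γ.E))
    (f := fun _ => (∑ e, Real.log (x e)) / N + κ / N * n) (g := fun e => Real.log (pathSum x n e))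
    Finset.univ_nonempty (by
      refine le_trans (le_of_eq ?_) h1
      rw [Finset.sum_const, Finset.card_univ, nsmul_eq_mul]
      change N * _ = (∑ e, Real.log (x e)) + n * κ
      field_simp)
  refine le_trans ?_ (hA n e)
  rwa [← Real.le_log_iff_exp_le (pathSum_pos (fun e => Real.exp_pos _) hq n e)]

/-- A graph without edges has a trivial fundamental group. -/
theorem nonempty_edges (m : MarkedMetricGraph F) {k : ℕ} (hk : 2 ≤ k)
    (b : FreeGroupBasis (Fin k) F) : Nonempty m.Γ.E := by
  have := m.finE
  have := m.finV
  have h1 := m.card_edges_eq b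
  have h2 : 0 < Nat.card m.Γ.V := Nat.card_pos_iff.2 ⟨⟨m.p⟩, inferInstance⟩
  exact (Nat.card_pos_iff.1 (by omega : 0 < Nat.card m.Γ.E)).1

/-- By connectedness, there is no vertex of degree zero. -/
theorem IsMinimal.three_le_degree {m : MarkedMetricGraph F} (hm : m.IsMinimal) {k : ℕ}
    (hk : 2 ≤ k) (b : FreeGroupBasis (Fin k) F) (v : m.Γ.V) : 3 ≤ m.Γ.degree v := by
  have := m.finE
  obtain ⟨e⟩ := m.nonempty_edges hk b
  have h0 : m.Γ.degree v ≠ 0 := by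
    obtain ⟨l, hl⟩ := m.connected v (m.Γ.o e)
    obtain ⟨f, hf⟩ : ∃ f, m.Γ.o f = v := by
      cases l with
      | nil => exact ⟨e, Eq.symm hl⟩
      | cons f l => exact ⟨f, hl.1⟩
    have : Nonempty {e // m.Γ.o e = v} := ⟨⟨f, hf⟩⟩
    exact (Nat.card_pos (α := {e // m.Γ.o e = v})).ne'
  have := hm v
  omega

theorem volume_eq (m : MarkedMetricGraph F) [Fintype m.Γ.E] :
    m.volume = 1 / 2 * ∑ e, m.L e := by
  rw [volume, finsum_eq_sum_of_fintype]

theorem entropy_ge (m : MarkedMetricGraph F) (hm : m.IsMinimal) (hvol : m.volume = 1) {k : ℕ}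
    (hk : 2 ≤ k) (b : FreeGroupBasis (Fin k) F) :
    (3 * (k : ℝ) - 3) * Real.log 2 ≤ m.entropy := by
  have := m.finE
  have := m.finV
  have := Fintype.ofFinite m.Γ.E
  have := Fintype.ofFinite m.Γ.V
  have hne := m.nonempty_edges hk b
  have hdeg := hm.three_le_degree hk b
  refine le_trans ?_ (m.sum_log_div_le_entropy hdeg)
  rw [volume_eq] at hvol
  rw [show ∑ e, m.L e = 2 by linarith,
    sum_comp_terminus fun v => Real.log (m.Γ.degree v - 1), le_div_iff₀ two_pos]
  refine le_trans (le_of_eq ?_) (Finset.sum_le_sum fun v _ => three_mul_log_two_mul_le (hdeg v))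
  have h1 : (∑ v, (m.Γ.degree v : ℝ)) + 2 = 2 * (k + Fintype.card m.Γ.V) := by
    have := m.card_edges_eq b
    rw [← sum_degree, Nat.card_eq_fintype_card] at this
    exact_mod_cast this
  rw [← Finset.mul_sum, Finset.sum_sub_distrib, Finset.sum_const, Finset.card_univ, nsmul_eq_mul]
  linear_combination (-3 * Real.log 2) * h1

theorem IsTrivalent.card_edges {m : MarkedMetricGraph F} (hm : m.IsTrivalent) {k : ℕ}
    (b : FreeGroupBasis (Fin k) F) : Nat.card m.Γ.E = 2 * (3 * k - 3) := by
  have := m.finE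
  have := m.finV
  have := Fintype.ofFinite m.Γ.V
  have h1 := m.card_edges_eq b
  have h2 : Nat.card m.Γ.E = 3 * Nat.card m.Γ.V := by
    rw [← sum_degree, Finset.sum_congr rfl fun v _ => hm v]
    simp [mul_comm]
  omega

theorem IsTrivalent.isMinimal {m : MarkedMetricGraph F} (hm : m.IsTrivalent) : m.IsMinimal :=
  fun v => by rw [hm v]; norm_num

theorem IsTrivalent.card_paths {m : MarkedMetricGraph F} [Fintype m.Γ.E] (hm : m.IsTrivalent)
    (n : ℕ) (e : m.Γ.E) : (paths n e).card = 2 ^ n := by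
  have h : ∀ n (e : m.Γ.E), pathSum (fun _ => 1) n e = 2 ^ n := by
    intro n
    induction n with
    | zero => intro e; simp [pathSum]
    | succ n ih =>
      intro e
      rw [pathSum, Finset.sum_congr rfl fun f _ => ih f, Finset.sum_const, card_succs, hm]
      simp [pow_succ, mul_comm]
  have h1 := sum_paths (fun _ : m.Γ.E => 1) n e
  rw [h] at h1
  simp only [List.map_const', List.prod_replicate, one_pow, Finset.sum_const, nsmul_eq_mul,
    mul_one] at h1
  exact_mod_cast h1

/-- A trivalent graph has at most exponentially many reduced edge-paths, with base `2`. -/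
theorem IsTrivalent.entropy_le {m : MarkedMetricGraph F} (hm : m.IsTrivalent) {ℓ : ℝ}
    (hℓ : 0 < ℓ) (hL : ∀ e, m.L e = ℓ) : m.entropy ≤ Real.log 2 / ℓ := by
  classical
  have := m.finE
  have := Fintype.ofFinite m.Γ.E
  set A : ℝ := 1 + Fintype.card m.Γ.E with hA
  have hA0 : 0 < A := by positivity
  have hcount : ∀ R, 0 ≤ R → (m.orbitCount m.x₀ R : ℝ) ≤ A * 2 ^ ⌊R / ℓ⌋₊ := by
    intro R hR
    have := finite_ball m.L_pos m.p m.p R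
    have := Fintype.ofFinite (Ball m.L m.p m.p R)
    set K := ⌊R / ℓ⌋₊ with hK
    have hsub : (Finset.univ.image fun a : Ball m.L m.p m.p R => a.1.word) ⊆
        insert [] (Finset.univ.biUnion fun e : m.Γ.E => (Finset.range K).biUnion fun n =>
          paths n e) := by
      intro l hl
      obtain ⟨⟨a, ha⟩, -, rfl⟩ := Finset.mem_image.1 hl
      have h1 := a.isReduced_word
      have h2 := a.isWalk_word
      rw [HC.len] at ha
      generalize a.word = l at *
      cases l with
      | nil => simp
      | cons e l =>
        have h3 := (length_mul_le_sum (fun e => (hL e).ge) (e :: l)).trans ha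
        rw [← le_div_iff₀ hℓ] at h3
        have h4 := Nat.le_floor h3
        rw [List.length_cons] at h4
        refine Finset.mem_insert_of_mem (Finset.mem_biUnion.2 ⟨e, Finset.mem_univ _,
          Finset.mem_biUnion.2 ⟨l.length, Finset.mem_range.2 h4, mem_paths.2
            ⟨l, rfl, rfl, h1, _, h2.2⟩⟩⟩)
    have h1 := Finset.card_le_card hsub
    rw [Finset.card_image_of_injective _ fun a a' h => Subtype.ext (HC.word_injective h),
      Finset.card_univ, ← Nat.card_eq_fintype_card] at h1
    have h2 : (insert [] (Finset.univ.biUnion fun e : m.Γ.E => (Finset.range K).biUnion fun n =>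
        paths n e)).card ≤ Fintype.card m.Γ.E * 2 ^ K + 1 := by
      refine (Finset.card_insert_le _ _).trans (Nat.add_le_add_right ?_ 1)
      refine Finset.card_biUnion_le_card_mul _ _ _ fun e _ => Finset.card_biUnion_le.trans ?_
      rw [Finset.sum_congr rfl fun n _ => hm.card_paths n e, Nat.geomSum_eq le_rfl]
      simp
    rw [orbitCount_eq]
    have h3 : (Nat.card (Ball m.L m.p m.p R) : ℝ) ≤ Fintype.card m.Γ.E * 2 ^ K + 1 := by
      exact_mod_cast h1.trans h2
    refine h3.trans ?_
    have h4 : (1 : ℝ) ≤ 2 ^ K := one_le_pow₀ one_le_two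
    rw [hA]
    linarith
  have hlim : Tendsto (fun R : ℝ => Real.log A / R + Real.log 2 / ℓ) atTop
      (𝓝 (Real.log 2 / ℓ)) := by
    simpa using ((tendsto_const_nhds (x := Real.log A)).div_atTop tendsto_id).add
      (tendsto_const_nhds (x := Real.log 2 / ℓ))
  refine le_of_tendsto_of_tendsto (m.tendsto_entropy m.x₀) hlim ?_
  filter_upwards [eventually_gt_atTop 0] with R hR
  have h1 : (0 : ℝ) < m.orbitCount m.x₀ R := by exact_mod_cast m.one_le_orbitCount hR.le
  have h2 := Real.log_le_log h1 (hcount R hR.le)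
  rw [Real.log_mul hA0.ne' (by positivity), Real.log_pow] at h2
  have h3 : (⌊R / ℓ⌋₊ : ℝ) * Real.log 2 ≤ R / ℓ * Real.log 2 :=
    mul_le_mul_of_nonneg_right (Nat.floor_le (by positivity)) (Real.log_nonneg one_le_two)
  rw [div_le_iff₀ hR, add_mul, div_mul_cancel₀ _ hR.ne']
  calc _ ≤ _ := h2
    _ ≤ _ := by
      have : Real.log 2 / ℓ * R = R / ℓ * Real.log 2 := by ring
      linarith

theorem IsTrivalent.volume_eq_one {m : MarkedMetricGraph F} (hm : m.IsTrivalent) {k : ℕ}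
    (hk : 2 ≤ k) (b : FreeGroupBasis (Fin k) F) (hL : ∀ e, m.L e = 1 / (3 * (k : ℝ) - 3)) :
    m.volume = 1 := by
  have := m.finE
  have := Fintype.ofFinite m.Γ.E
  have h1 := hm.card_edges b
  rw [Nat.card_eq_fintype_card] at h1
  have h2 : (2 : ℝ) ≤ k := by exact_mod_cast hk
  have h3 : (3 * (k : ℝ) - 3) ≠ 0 := by linarith
  rw [volume_eq, Finset.sum_congr rfl fun e _ => hL e, Finset.sum_const, Finset.card_univ, h1,
    nsmul_eq_mul, Nat.cast_mul, Nat.cast_sub (by omega)]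
  push_cast
  rw [mul_assoc, mul_one_div_cancel h3]
  norm_num

theorem IsTrivalent.entropy_eq {m : MarkedMetricGraph F} (hm : m.IsTrivalent) {k : ℕ}
    (hk : 2 ≤ k) (b : FreeGroupBasis (Fin k) F) (hL : ∀ e, m.L e = 1 / (3 * (k : ℝ) - 3)) :
    m.entropy = (3 * (k : ℝ) - 3) * Real.log 2 := by
  have h2 : (2 : ℝ) ≤ k := by exact_mod_cast hk
  refine le_antisymm ((hm.entropy_le (one_div_pos.2 (by linarith)) hL).trans_eq ?_)
    (m.entropy_ge hm.isMinimal (hm.volume_eq_one hk b hL) hk b)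
  rw [div_div_eq_mul_div, div_one, mul_comm]

end MarkedMetricGraph

/-! ### Trivalent graphs of every rank -/

namespace SerreGraph

/-- The path with the vertices `0, …, n`, to which an edge from `a i` to `c i` is added for every
`i : ι`. The edges of the path are indexed by `Fin n`; the Boolean value is the orientation. -/
abbrev pathWithChords {ι : Type} (n : ℕ) (a c : ι → Fin (n + 1)) : SerreGraph where
  V := Fin (n + 1)
  E := (ι × Bool) ⊕ (Fin n × Bool)
  o
    | .inl (i, true) => a i
    | .inl (i, false) => c i
    | .inr (j, true) => j.castSucc
    | .inr (j, false) => j.succ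
  inv
    | .inl (i, s) => .inl (i, !s)
    | .inr (j, s) => .inr (j, !s)
  inv_inv := by rintro (⟨i, s⟩ | ⟨j, s⟩) <;> simp
  inv_ne := by rintro (⟨i, s⟩ | ⟨j, s⟩) <;> simp

variable {ι : Type} {n : ℕ} (a c : ι → Fin (n + 1))

/-- The class of the initial segment of the path that ends at the vertex `v`. -/
def pathHC (v : Fin (n + 1)) : (pathWithChords n a c).HC (0 : Fin (n + 1)) v :=
  Fin.induction (motive := fun v => (pathWithChords n a c).HC (0 : Fin (n + 1)) v)
    (HC.one (Γ := pathWithChords n a c) (0 : Fin (n + 1)))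
    (fun j x => x.comp (HC.edge (Γ := pathWithChords n a c) (.inr (j, true)))) v

theorem connected_pathWithChords : (pathWithChords n a c).Connected := by
  intro u v
  obtain ⟨w, -⟩ := Quot.exists_rep ((pathHC a c u).symm.comp (pathHC a c v))
  exact ⟨w⟩

variable {F : Type*} [Group F]

/-- The cochain that is trivial on the path and equal to `x i` on the chord `i`. -/
def chordCochain (x : ι → F) : (pathWithChords n a c).Cochain F :=
  ⟨fun
    | .inl (i, true) => x i
    | .inl (i, false) => (x i)⁻¹
    | .inr _ => 1, by rintro (⟨i, _ | _⟩ | ⟨j, s⟩) <;> simp⟩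

theorem hol_pathHC (x : ι → F) (v : Fin (n + 1)) :
    (pathHC a c v).hol (chordCochain a c x).1 (chordCochain a c x).2 = 1 := by
  induction v using Fin.induction with
  | zero => rfl
  | succ j ih =>
    refine (HC.hol_comp (chordCochain a c x).2 (pathHC a c j.castSucc)
      (HC.edge (Γ := pathWithChords n a c) (.inr (j, true)))).trans ?_
    rw [ih, one_mul]
    exact HC.hol_edge _ _

/-- The loop at `0` that runs along the path, then along `x`, and back along the path. -/
def loopThrough {u v : Fin (n + 1)} (x : (pathWithChords n a c).HC u v) :
    (pathWithChords n a c).Pi1 (0 : Fin (n + 1)) :=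
  ((pathHC a c u).comp x).comp (pathHC a c v).symm

theorem hol_loopThrough (x : ι → F) {u v : Fin (n + 1)} (y : (pathWithChords n a c).HC u v) :
    (loopThrough a c y).hol (chordCochain a c x).1 (chordCochain a c x).2 =
      y.hol (chordCochain a c x).1 (chordCochain a c x).2 := by
  rw [loopThrough, HC.hol_comp, HC.hol_comp, HC.hol_symm, hol_pathHC, hol_pathHC]
  simp

theorem loopThrough_comp {u v w : Fin (n + 1)} (x : (pathWithChords n a c).HC u v)
    (y : (pathWithChords n a c).HC v w) :
    loopThrough a c (x.comp y) = loopThrough a c x * loopThrough a c y := by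
  change ((pathHC a c u).comp (x.comp y)).comp (pathHC a c w).symm =
    (((pathHC a c u).comp x).comp (pathHC a c v).symm).comp
      (((pathHC a c v).comp y).comp (pathHC a c w).symm)
  simp [HC.comp_assoc]

theorem loopThrough_path (j : Fin n) :
    loopThrough a c (HC.edge (Γ := pathWithChords n a c) (.inr (j, true))) = 1 := by
  have h : loopThrough a c (HC.edge (Γ := pathWithChords n a c) (.inr (j, true))) =
      (pathHC a c j.succ).comp (pathHC a c j.succ).symm := rfl
  rw [h, HC.comp_symm]
  rfl

/-- The fundamental group of a path with chords is free on the loops through the chords. -/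
def pi1Equiv (b : FreeGroupBasis ι F) :
    F ≃* (pathWithChords n a c).Pi1 (0 : Fin (n + 1)) :=
  let Γ := pathWithChords n a c
  let ψ : F →* Γ.Pi1 (0 : Fin (n + 1)) :=
    b.lift fun i => loopThrough a c (HC.edge (Γ := Γ) (.inl (i, true)))
  MulEquiv.ofBijective ψ (by
    have hinv := HC.functor_inv (Γ := Γ) (fun u v => loopThrough a c (u := u) (v := v))
      (fun u v w => loopThrough_comp a c)
    have hψ : ∀ i, ψ (b i) = loopThrough a c (HC.edge (Γ := Γ) (.inl (i, true))) := by
      intro i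
      simp [ψ]
    constructor
    -- the holonomy of the cochain given by the basis is a left inverse
    · have h : (HC.holHom (chordCochain a c b).1 (chordCochain a c b).2 _).comp ψ =
          MonoidHom.id F := by
        refine b.ext_hom _ _ fun i => ?_
        rw [MonoidHom.comp_apply, hψ]
        exact (hol_loopThrough a c b _).trans (HC.hol_edge _ _)
      exact Function.LeftInverse.injective (DFunLike.congr_fun h)
    -- `ψ` of the holonomy and `loopThrough` are functors which agree on the edges
    · intro g
      have hφ : ∀ e : Γ.E, loopThrough a c (HC.edge (Γ := Γ) e) =
          ψ ((chordCochain a c b).1 e) := by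
        rintro (⟨i, _ | _⟩ | ⟨j, _ | _⟩)
        · exact (hinv (.inl (i, true))).trans ((congrArg _ (hψ i).symm).trans (map_inv ψ _).symm)
        · exact (hψ i).symm
        · refine (hinv (.inr (j, true))).trans ?_
          rw [loopThrough_path, inv_one]
          exact (map_one ψ).symm
        · exact (loopThrough_path a c j).trans (map_one ψ).symm
      have hcochain : ∀ e : Γ.E, ψ ((chordCochain a c b).1 (Γ.inv e)) =
          (ψ ((chordCochain a c b).1 e))⁻¹ := fun e => by
        rw [(chordCochain a c b).2, map_inv]
      have h1 := HC.hol_eq_functor (Γ := Γ) (fun u v => loopThrough a c (u := u) (v := v))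
        (fun u v w => loopThrough_comp a c) hcochain hφ g
      have h2 := HC.hol_eq_functor (Γ := Γ)
        (fun u v x => ψ (HC.hol (chordCochain a c b).1 (chordCochain a c b).2 x))
        (fun u v w x y => by rw [HC.hol_comp, map_mul]) hcochain
        (fun e => congrArg ψ (HC.hol_edge _ e)) g
      refine ⟨_, h2.symm.trans (h1.trans ?_)⟩
      exact (HC.comp_one _).trans (HC.one_comp _))

theorem three_le_degree {Γ : SerreGraph} [Finite Γ.E] {v : Γ.V} {e₁ e₂ e₃ : Γ.E}
    (h₁ : Γ.o e₁ = v) (h₂ : Γ.o e₂ = v) (h₃ : Γ.o e₃ = v) (h₁₂ : e₁ ≠ e₂) (h₁₃ : e₁ ≠ e₃)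
    (h₂₃ : e₂ ≠ e₃) : 3 ≤ Γ.degree v := by
  classical
  have := Fintype.ofFinite {e : Γ.E // Γ.o e = v}
  rw [degree, Nat.card_eq_fintype_card, Nat.succ_le_iff, Fintype.two_lt_card_iff]
  exact ⟨⟨e₁, h₁⟩, ⟨e₂, h₂⟩, ⟨e₃, h₃⟩, by simpa using h₁₂, by simpa using h₁₃, by simpa using h₂₃⟩

/-- A trivalent graph of rank `j + 2`: the path with the vertices `0, …, 2j + 1`, where a loop is
added at each end and the edge from `2i - 1` to `2i` is doubled for `1 ≤ i ≤ j`. -/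
abbrev loopChain (j : ℕ) : SerreGraph :=
  pathWithChords (ι := Fin (j + 2)) (2 * j + 1) (fun i => ⟨2 * i - 1, by omega⟩)
    (fun i => ⟨min (2 * i) (2 * j + 1), by omega⟩)

theorem three_le_degree_loopChain (j : ℕ) (v : Fin (2 * j + 2)) :
    3 ≤ (loopChain j).degree v := by
  have : Finite (loopChain j).E := inferInstanceAs (Finite ((Fin (j + 2) × Bool) ⊕ _))
  obtain ⟨v, hv⟩ := v
  rcases Nat.eq_zero_or_pos v with rfl | hv0
  · exact three_le_degree (Γ := loopChain j) (e₁ := .inl (0, true)) (e₂ := .inl (0, false))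
      (e₃ := .inr (0, true)) (Fin.ext (by simp)) (Fin.ext (by simp)) (Fin.ext (by simp))
      (by simp) (by simp) (by simp)
  rcases Nat.eq_or_lt_of_le (Nat.lt_succ_iff.1 hv) with rfl | hv1
  · exact three_le_degree (Γ := loopChain j) (e₁ := .inl (Fin.last _, true))
      (e₂ := .inl (Fin.last _, false)) (e₃ := .inr (Fin.last _, false))
      (Fin.ext (by simp; omega)) (Fin.ext (by simp)) (Fin.ext (by simp))
      (by simp) (by simp) (by simp)
  · have h₁ : (loopChain j).o (.inr (⟨v, hv1⟩, true)) = (⟨v, hv⟩ : Fin (2 * j + 2)) := rfl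
    have h₂ : (loopChain j).o (.inr (⟨v - 1, by omega⟩, false)) = (⟨v, hv⟩ : Fin (2 * j + 2)) :=
      Fin.ext (by simp; omega)
    rcases Nat.even_or_odd' v with ⟨i, hi | hi⟩
    · exact three_le_degree (Γ := loopChain j) h₁ h₂
        (e₃ := .inl (⟨i, by omega⟩, false)) (Fin.ext (by simp; omega))
        (by simp) (by simp) (by simp)
    · exact three_le_degree (Γ := loopChain j) h₁ h₂
        (e₃ := .inl (⟨i + 1, by omega⟩, true)) (Fin.ext (by simp; omega))
        (by simp) (by simp) (by simp)

/-- All degrees are at least three, and their sum is three times the number of vertices. -/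
theorem degree_loopChain (j : ℕ) (v : Fin (2 * j + 2)) : (loopChain j).degree v = 3 := by
  have : Finite (loopChain j).E := inferInstanceAs (Finite ((Fin (j + 2) × Bool) ⊕ _))
  have h : ∑ _v : Fin (2 * j + 2), 3 = ∑ v : Fin (2 * j + 2), (loopChain j).degree v := by
    rw [sum_degree (Γ := loopChain j)]
    simp only [Finset.sum_const, Finset.card_univ, Fintype.card_fin, Nat.card_eq_fintype_card,
      Fintype.card_sum, Fintype.card_prod, Fintype.card_bool, smul_eq_mul]
    ring
  exact ((Finset.sum_eq_sum_iff_of_le fun v _ => three_le_degree_loopChain j v).1 h v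
    (Finset.mem_univ v)).symm

end SerreGraph

/-- The marked metric graph given by `loopChain` and a free basis of `F`, with all edges of length
`ℓ`. -/
def loopChainMarked {F : Type*} [Group F] {j : ℕ} (b : FreeGroupBasis (Fin (j + 2)) F) {ℓ : ℝ}
    (hℓ : 0 < ℓ) : MarkedMetricGraph F where
  Γ := loopChain j
  finV := inferInstanceAs (Finite (Fin _))
  finE := inferInstanceAs (Finite (_ ⊕ _))
  connected := connected_pathWithChords _ _
  degree_ne_one v := by rw [degree_loopChain]; norm_num
  p := (0 : Fin _)
  α := pi1Equiv _ _ b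
  L _ := ℓ
  L_inv _ := rfl
  L_pos _ := hℓ

end OuterSpace

end

theorem theorem8p4 {F : Type*} [Group F] (k : ℕ) (hk : 2 ≤ k) (b : FreeGroupBasis (Fin k) F) :
    -- the limit that defines the volume entropy exists, for every base vertex of the cover
    (∀ (m : OuterSpace.VolOneMin F) (x : m.1.X.V),
      Filter.Tendsto (fun R : ℝ => Real.log (m.1.orbitCount x R) / R) Filter.atTop
        (nhds (OuterSpace.Moduli.entropy (OuterSpace.Moduli.mk m)))) ∧
    -- the minimum
    IsLeast (Set.range (OuterSpace.Moduli.entropy (F := F))) ((3 * (k : ℝ) - 3) * Real.log 2) ∧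
    -- trivalent graphs with all edges of equal length
    (∀ m : OuterSpace.MarkedMetricGraph F, m.IsTrivalent →
      Nat.card m.Γ.E = 2 * (3 * k - 3) ∧
      ((∀ e, m.L e = 1 / (3 * (k : ℝ) - 3)) →
        ∃ hm : m.IsMinimal ∧ m.volume = 1,
          OuterSpace.Moduli.entropy (OuterSpace.Moduli.mk ⟨m, hm⟩) =
            (3 * (k : ℝ) - 3) * Real.log 2)) := by
  refine ⟨fun m x => m.1.tendsto_entropy x, ⟨?_, ?_⟩, fun m hm => ⟨hm.card_edges b, fun hL =>
    ⟨⟨hm.isMinimal, hm.volume_eq_one hk b hL⟩, hm.entropy_eq hk b hL⟩⟩⟩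
  · obtain ⟨j, rfl⟩ := Nat.exists_eq_add_of_le' hk
    have hℓ : 0 < 1 / (3 * ((j + 2 : ℕ) : ℝ) - 3) := by
      push_cast
      exact one_div_pos.2 (by linarith [Nat.cast_nonneg (α := ℝ) j])
    have htri : (OuterSpace.loopChainMarked b hℓ).IsTrivalent :=
      OuterSpace.SerreGraph.degree_loopChain j
    exact ⟨OuterSpace.Moduli.mk ⟨OuterSpace.loopChainMarked b hℓ, htri.isMinimal,
      htri.volume_eq_one hk b fun _ => rfl⟩, htri.entropy_eq hk b fun _ => rfl⟩
  · rintro _ ⟨x, rfl⟩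
    induction x using Quotient.ind with | _ x => ?_
    induction x using Quotient.ind with | _ m => ?_
    exact m.1.entropy_ge m.2.1 m.2.2 hk b
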